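/- Corollary 1. Two networks $l=1,2$ of $n_l$ agents play a stochastic zero-sum game. **Game.** $X_l\subset\mathbb R^{m_l}$ is compact and convex, $\mathbb R^{m_l}$ carries a norm $\|\cdot\|$ with dual norm $\|\cdot\|_*$, and $O_l\supseteq X_l$ is open and convex. Agent $i$ of network $1$ has a cost $f_{1,i}(x_1,x_2)=\mathbb E[\psi_{1,i}(x_1,x_2;\xi)]$ on $O_1\times X_2$, convex in $x_1\in O_1$ and concave in $x_2\in X_2$; agent $j$ of network $2$ has a cost $f_{2,j}(x_1,x_2)=\mathbb E[\psi_{2,j}(x_1,x_2;\xi)]$ on $X_1\times O_2$, convex in $x_2\in O_2$ and concave in $x_1\in X_1$; $\xi$ is a random vector in $\mathbb R^d$. On $X_1\times X_2$, $U:=\frac1{n_1}\sum_i f_{1,i}=-\frac1{n_2}\sum_j f_{2,j}$. There is $L>0$ with $|f_{l,i}(x_1,x_2)-f_{l,i}(x_1',x_2')|\le L(\|x_1-x_1'\|+\|x_2-x_2'\|)$ on the domain of $f_{l,i}$. Partial subdifferentials $\partial_l$ in the variable $x_l$ are taken relative to $O_l$. **Communication.** The edge sets $\mathcal E_l(t)$,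 $t\ge0$, on $\{1,\dots,n_l\}$ contain all loops $(i,i)$, and for some $B_l\ge1$ the union $\bigcup_{t=k}^{k+B_l-1}\mathcal E_l(t)$ is strongly connected for every $k\ge0$. The matrices $W_l(t)=(w_{l,ij}(t))$ are doubly stochastic, with $w_{l,ij}(t)\ge\eta$ if $(j,i)\in\mathcal E_l(t)$ and $w_{l,ij}(t)=0$ otherwise, where $0<\eta<1$. The weights $w_{12,ij}(t)\ge0$ that agent $i$ of network $l$ gives to the agents $j$ of network $3-l$ (positive only along edges of the bipartite graph between the networks) sum to $1$ over $j$. **Algorithm (D-SMD).** $\psi_l$ is a differentiable function on $X_l$ that is $1$-strongly convex with respect to $\|\cdot\|$; its Bregman divergence $D_{\psi_l}(x,p)=\psi_l(x)-\psi_l(p)-\langle\nabla\psi_l(p),x-p\rangle$ is convex in $p$, satisfies $D_{\psi_l}(x_k,x)\to0$ whenever $x_k\to x$ in $X_l$, and $R_1^2:=\sup_{x,x'\in X_1}D_{\psi_1}(x,x')<\infty$. Starting from (possibly random) $x_{l,i}(0)\in X_l$ with $\|x_{l,i}(0)\|\le\Lambda_l$, put, for $t\ge0$, $$v_{l,i}(t)=\sum_j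 w_{l,ij}(t)x_{l,j}(t),\qquad u_{3-l,i}(t)=\sum_j w_{12,ij}(t)x_{3-l,j}(t),$$ $$x_{l,i}(t+1)=\arg\min_{x'\in X_l}\{\alpha(t)\langle\hat g_{l,i}(t),x'-v_{l,i}(t)\rangle+D_{\psi_l}(x',v_{l,i}(t))\},$$ where $\hat g_{l,i}(t)$ is a subgradient in the own variable $x_l$ of $\psi_{l,i}(\cdot,\cdot;\xi_{l,i}(t))$ at own strategy $v_{l,i}(t)$ and opponent strategy $u_{3-l,i}(t)$, and the $\xi_{l,i}(t)$ are i.i.d. copies of $\xi$. Let $\mathcal F_t=\sigma(x_{l,i}(0),\xi_{l,i}(s):l=1,2,\ i\le n_l,\ s<t)$. The $\hat g_{l,i}(t)$ are $\mathcal F_{t+1}$-measurable, and there are $\nu_l>0$ and $g_{1,i}(t)\in\partial_1f_{1,i}(v_{1,i}(t),u_{2,i}(t))$, $g_{2,i}(t)\in\partial_2f_{2,i}(u_{1,i}(t),v_{2,i}(t))$ with $\mathbb E[\hat g_{l,i}(t)\mid\mathcal F_t]=g_{l,i}(t)$ and $\mathbb E[\|g_{l,i}(t)-\hat g_{l,i}(t)\|_*^2\mid\mathcal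 F_t]\le\nu_l^2$. **Claim.** Let $\epsilon\in[0,\frac12)$, let $\alpha(t)=t^{-(1/2+\epsilon)}$ for $t\ge1$, and let $\alpha(0)\ge\alpha(1)$ be arbitrary. Then there is a constant $C$, depending only on $n_l,B_l,\eta,L,\nu_l,\Lambda_l,R_1^2,\epsilon$ and $\alpha(0)$, such that for every agent $i$ of network $1$ and every $T\ge1$ the pseudo regret $$\bar R_1^{(i)}(T)=\mathbb E\Big[\sum_{t=1}^TU(x_{1,i}(t),u_{2,i}(t))\Big]-\min_{x_1\in X_1}\mathbb E\Big[\sum_{t=1}^TU(x_1,u_{2,i}(t))\Big]$$ is well defined (the expectations exist and the minimum is attained) and satisfies $\bar R_1^{(i)}(T)\le C\,T^{1/2+\epsilon}$. In particular, $\bar R_1^{(i)}(T)\le C\sqrt T$ if $\alpha(t)=1/\sqrt t$ for $t\ge1$. -/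

import Mathlib

open MeasureTheory ProbabilityTheory Filter Topology

universe u v w

/-! Throughout, `ℝ^m` with an arbitrary norm is modelled by a finite-dimensional real normed space
`E`; covectors (subgradients) live in the dual `E →L[ℝ] ℝ`, whose operator norm is the dual norm
`‖y‖_* = sup_{‖x‖ ≤ 1} ⟨y, x⟩`. The first space `E` is the one of the network under consideration
("own"), the second space `F` the one of the adversarial network ("opponent"). -/

namespace DSMD

noncomputable section

/-- Bregman divergence `D_ψ(x,p) = ψ(x) - ψ(p) - ⟨∇ψ(p), x - p⟩` for `x, p ∈ X`. The derivative is
the one relative to `X`; on a convex set its value on `x - p` is uniquely determined. -/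
def bregman {E : Type u} [NormedAddCommGroup E] [NormedSpace ℝ E]
    (X : Set E) (ψ : E → ℝ) (x p : E) : ℝ :=
  ψ x - ψ p - fderivWithin ℝ ψ X p (x - p)

/-- `z = P_x(y)`: `z` minimizes `x' ↦ ⟨y, x - x'⟩ + D_ψ(x', x)` over `X`. -/
def IsProx {E : Type u} [NormedAddCommGroup E] [NormedSpace ℝ E]
    (X : Set E) (ψ : E → ℝ) (x : E) (y : E →L[ℝ] ℝ) (z : E) : Prop :=
  z ∈ X ∧ IsMinOn (fun x' => y (x - x') + bregman X ψ x' x) X z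

/-- A differentiable regularizer, 1-strongly convex with respect to the norm, with Bregman divergence
convex in the second argument and satisfying the reciprocity condition. -/
structure IsRegularizer {E : Type u} [NormedAddCommGroup E] [NormedSpace ℝ E]
    (X : Set E) (ψ : E → ℝ) : Prop where
  strong : StrongConvexOn X 1 ψ
  diff : DifferentiableOn ℝ ψ X
  convex_right : ∀ x ∈ X, ConvexOn ℝ X (fun y => bregman X ψ x y)
  reciprocity : ∀ x ∈ X, ∀ z : ℕ → E, (∀ k, z k ∈ X) → Tendsto z atTop (𝓝 x) →
    Tendsto (fun k => bregman X ψ (z k) x) atTop (𝓝 0)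

/-- `g` is a subgradient at `p` of the function `h` with domain `O`. -/
def IsSubgradient {E : Type u} [NormedAddCommGroup E] [NormedSpace ℝ E]
    (O : Set E) (h : E → ℝ) (p : E) (g : E →L[ℝ] ℝ) : Prop :=
  ∀ y ∈ O, h p + g (y - p) ≤ h y

/-- Time-varying communication inside one network; `edge t j i` says that `(j,i)` is an edge at time
`t`, and `W t i j` is the weight that agent `i` gives to agent `j`. Every agent is its own neighbour,
the graphs are uniformly jointly strongly connected over windows of length `B`, and the weights are
doubly stochastic and at least `η` on edges. -/
structure IsMixing {n : ℕ} (edge : ℕ → Fin n → Fin n → Prop)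
    (W : ℕ → Matrix (Fin n) (Fin n) ℝ) (η : ℝ) (B : ℕ) : Prop where
  one_le_B : 1 ≤ B
  self_loop : ∀ t i, edge t i i
  connected : ∀ k i j, Relation.ReflTransGen (fun a b => ∃ t, k ≤ t ∧ t < k + B ∧ edge t a b) i j
  weight_ge : ∀ t i j, edge t j i → η ≤ W t i j
  weight_zero : ∀ t i j, ¬ edge t j i → W t i j = 0
  row_sum : ∀ t i, ∑ j, W t i j = 1
  col_sum : ∀ t j, ∑ i, W t i j = 1

/-- Communication from the `m` agents of the opponent to the `n` agents of a network. -/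
structure IsCrossMixing {n m : ℕ} (edge : ℕ → Fin m → Fin n → Prop)
    (W : ℕ → Matrix (Fin n) (Fin m) ℝ) : Prop where
  nonneg : ∀ t i j, 0 ≤ W t i j
  support : ∀ t i j, 0 < W t i j → edge t j i
  row_sum : ∀ t i, ∑ j, W t i j = 1

/-- The data of one network with `n` agents, facing an opponent with `m` agents: strategy set `X`, an
open domain `O ⊇ X` of the own variable of the costs, regularizer `reg`, communication inside the
network and from the opponent, and the sampled costs `sample i x y ζ` of agent `i`, where `x` is the
own strategy, `y` the strategy of the opponent and `ζ` a value of the random vector. -/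
structure Network (E : Type u) (F : Type v) (n m d : ℕ) where
  X : Set E
  O : Set E
  reg : E → ℝ
  edge : ℕ → Fin n → Fin n → Prop
  W : ℕ → Matrix (Fin n) (Fin n) ℝ
  crossEdge : ℕ → Fin m → Fin n → Prop
  crossW : ℕ → Matrix (Fin n) (Fin m) ℝ
  sample : Fin n → E → F → (Fin d → ℝ) → ℝ

/-- The random sequences of one network: iterates `x`, samples `ξ`, sampled subgradients `gHat` and
subgradients `g` of the expected costs. -/
structure Iterates (Ω : Type w) (E : Type u) [NormedAddCommGroup E] [NormedSpace ℝ E]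
    (n d : ℕ) where
  x : ℕ → Fin n → Ω → E
  ξ : ℕ → Fin n → Ω → (Fin d → ℝ)
  gHat : ℕ → Fin n → Ω → (E →L[ℝ] ℝ)
  g : ℕ → Fin n → Ω → (E →L[ℝ] ℝ)

section OneNetwork

variable {Ω : Type w} [MeasurableSpace Ω]
  {E : Type u} [NormedAddCommGroup E] [NormedSpace ℝ E]
  {F : Type v} [NormedAddCommGroup F] [NormedSpace ℝ F] {n m d : ℕ}

/-- Expected cost of agent `i`: `f_i(x,y) = 𝔼[ψ_i(x,y;ξ)]`. -/
def Network.cost (N : Network E F n m d) (P : Measure Ω) (ξ : Ω → (Fin d → ℝ))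
    (i : Fin n) (x : E) (y : F) : ℝ :=
  ∫ ω, N.sample i x y (ξ ω) ∂P

/-- Average cost of the network. -/
def Network.avgCost (N : Network E F n m d) (P : Measure Ω) (ξ : Ω → (Fin d → ℝ))
    (x : E) (y : F) : ℝ :=
  (1 / (n : ℝ)) * ∑ i, N.cost P ξ i x y

/-- `v_i(t) = ∑_j w_ij(t) x_j(t)`. -/
def Network.v (N : Network E F n m d) (p : Iterates Ω E n d) (t : ℕ) (i : Fin n) (ω : Ω) : E :=
  ∑ j, N.W t i j • p.x t j ω

/-- The weighted information `u_i(t)` that agent `i` receives on the strategies of the opponent. -/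
def Network.u (N : Network E F n m d) (q : Iterates Ω F m d) (t : ℕ) (i : Fin n) (ω : Ω) : F :=
  ∑ j, N.crossW t i j • q.x t j ω

/-- Conditions on the strategy set, the costs and the communication of one network, whose opponent
has the strategy set `Y`. -/
structure Network.IsAdmissible (N : Network E F n m d) (Y : Set F) (P : Measure Ω)
    (ξ : Ω → (Fin d → ℝ)) (η : ℝ) (B : ℕ) (L : ℝ) : Prop where
  X_compact : IsCompact N.X
  X_convex : Convex ℝ N.X
  O_open : IsOpen N.O
  X_subset : N.X ⊆ N.O
  regularizer : IsRegularizer N.X N.reg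
  mixing : IsMixing N.edge N.W η B
  cross : IsCrossMixing N.crossEdge N.crossW
  integrable : ∀ i, ∀ x ∈ N.O, ∀ y ∈ Y, Integrable (fun ω => N.sample i x y (ξ ω)) P
  convex_own : ∀ i, ∀ y ∈ Y, ConvexOn ℝ N.O (fun x => N.cost P ξ i x y)
  concave_opp : ∀ i, ∀ x ∈ N.X, ConcaveOn ℝ Y (fun y => N.cost P ξ i x y)
  lipschitz : ∀ i, ∀ x ∈ N.O, ∀ x' ∈ N.O, ∀ y ∈ Y, ∀ y' ∈ Y,
    |N.cost P ξ i x y - N.cost P ξ i x' y'| ≤ L * (‖x - x'‖ + ‖y - y'‖)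

/-- The sequences of one network are produced by distributed stochastic mirror descent with step sizes
`α`; the opponent's sequences are `q`, and `ℱ t` is the information available at time `t`. -/
structure IsRun [MeasurableSpace E] (N : Network E F n m d) (p : Iterates Ω E n d)
    (q : Iterates Ω F m d) (P : Measure Ω) (ξ : Ω → (Fin d → ℝ)) (α : ℕ → ℝ)
    (ℱ : ℕ → MeasurableSpace Ω) : Prop where
  init_mem : ∀ i ω, p.x 0 i ω ∈ N.X
  init_meas : ∀ i, Measurable (p.x 0 i)
  sample_meas : ∀ t i, Measurable (p.ξ t i)
  sample_law : ∀ t i, IdentDistrib (p.ξ t i) ξ P P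
  gHat_meas : ∀ t i, StronglyMeasurable[ℱ (t + 1)] (p.gHat t i)
  gHat_sub : ∀ t i, ∀ᵐ ω ∂P, IsSubgradient N.O
    (fun x => N.sample i x (N.u q t i ω) (p.ξ t i ω)) (N.v p t i ω) (p.gHat t i ω)
  update : ∀ t i ω,
    IsProx N.X N.reg (N.v p t i ω) (-(α t • p.gHat t i ω)) (p.x (t + 1) i ω)

/-- The sampled subgradients are conditionally unbiased with conditional variance at most `ν²`. -/
structure IsUnbiased (N : Network E F n m d) (p : Iterates Ω E n d)
    (q : Iterates Ω F m d) (P : Measure Ω) (ξ : Ω → (Fin d → ℝ)) (ν : ℝ)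
    (ℱ : ℕ → MeasurableSpace Ω) : Prop where
  g_sub : ∀ t i, ∀ᵐ ω ∂P, IsSubgradient N.O
    (fun x => N.cost P ξ i x (N.u q t i ω)) (N.v p t i ω) (p.g t i ω)
  gHat_int : ∀ t i, Integrable (p.gHat t i) P
  unbiased : ∀ t i, P[p.gHat t i | ℱ t] =ᵐ[P] p.g t i
  sq_int : ∀ t i, Integrable (fun ω => ‖p.g t i ω - p.gHat t i ω‖ ^ 2) P
  variance : ∀ t i, P[fun ω => ‖p.g t i ω - p.gHat t i ω‖ ^ 2 | ℱ t] ≤ᵐ[P] fun _ => ν ^ 2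

end OneNetwork

section TwoNetworks

variable {Ω : Type w} {E₁ : Type u} [NormedAddCommGroup E₁] [NormedSpace ℝ E₁] [MeasurableSpace E₁]
  {E₂ : Type v} [NormedAddCommGroup E₂] [NormedSpace ℝ E₂] [MeasurableSpace E₂] {n₁ n₂ d : ℕ}

/-- `ℱ_t = σ(x_{l,i}(0), ξ_{l,i}(s) : l = 1,2, i ∈ V_l, s < t)`. -/
abbrev info (p₁ : Iterates Ω E₁ n₁ d) (p₂ : Iterates Ω E₂ n₂ d) (t : ℕ) : MeasurableSpace Ω :=
  (⨆ i, MeasurableSpace.comap (p₁.x 0 i) inferInstance) ⊔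
  (⨆ j, MeasurableSpace.comap (p₂.x 0 j) inferInstance) ⊔
  (⨆ s : Fin t, ⨆ i, MeasurableSpace.comap (p₁.ξ s i) inferInstance) ⊔
  (⨆ s : Fin t, ⨆ j, MeasurableSpace.comap (p₂.ξ s j) inferInstance)

/-- The family of all samples, of both networks and at all times. -/
def allSamples (p₁ : Iterates Ω E₁ n₁ d) (p₂ : Iterates Ω E₂ n₂ d) :
    (Fin n₁ ⊕ Fin n₂) × ℕ → Ω → (Fin d → ℝ) :=
  fun a => Sum.elim (p₁.ξ a.2) (p₂.ξ a.2) a.1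

/-- A two-network stochastic zero-sum game together with a run of distributed stochastic mirror
descent with step sizes `α`. The costs of the second network take its own strategy first, so that the
zero-sum condition reads `U(x₁,x₂) = (1/n₁) ∑ f_{1,i} = -(1/n₂) ∑ f_{2,j}`. The constant `R` bounds
the Bregman diameter of the first strategy set and `Λ_l` the norms of the initial points. -/
structure IsGameRun [MeasurableSpace Ω] (N₁ : Network E₁ E₂ n₁ n₂ d) (N₂ : Network E₂ E₁ n₂ n₁ d)
    (p₁ : Iterates Ω E₁ n₁ d) (p₂ : Iterates Ω E₂ n₂ d) (P : Measure Ω) (ξ : Ω → (Fin d → ℝ))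
    (B₁ B₂ : ℕ) (η L ν₁ ν₂ Λ₁ Λ₂ R : ℝ) (α : ℕ → ℝ) : Prop where
  adm₁ : N₁.IsAdmissible N₂.X P ξ η B₁ L
  adm₂ : N₂.IsAdmissible N₁.X P ξ η B₂ L
  zero_sum : ∀ x₁ ∈ N₁.X, ∀ x₂ ∈ N₂.X, N₁.avgCost P ξ x₁ x₂ = -N₂.avgCost P ξ x₂ x₁
  run₁ : IsRun N₁ p₁ p₂ P ξ α (info p₁ p₂)
  run₂ : IsRun N₂ p₂ p₁ P ξ α (info p₁ p₂)
  indep : iIndepFun (allSamples p₁ p₂) P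
  unbiased₁ : IsUnbiased N₁ p₁ p₂ P ξ ν₁ (info p₁ p₂)
  unbiased₂ : IsUnbiased N₂ p₂ p₁ P ξ ν₂ (info p₁ p₂)
  diam : ∀ x ∈ N₁.X, ∀ x' ∈ N₁.X, bregman N₁.X N₁.reg x x' ≤ R
  init₁ : ∀ i ω, ‖p₁.x 0 i ω‖ ≤ Λ₁
  init₂ : ∀ j ω, ‖p₂.x 0 j ω‖ ≤ Λ₂

/-- Cumulated cost `∑_{t=1}^T U(x_{1,i}(t), u_{2,i}(t))` of agent `i` of the first network. -/
def playedCost [MeasurableSpace Ω] (N₁ : Network E₁ E₂ n₁ n₂ d) (p₁ : Iterates Ω E₁ n₁ d)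
    (p₂ : Iterates Ω E₂ n₂ d) (P : Measure Ω) (ξ : Ω → (Fin d → ℝ)) (i : Fin n₁) (T : ℕ) (ω : Ω) : ℝ :=
  ∑ t ∈ Finset.Icc 1 T, N₁.avgCost P ξ (p₁.x t i ω) (N₁.u p₂ t i ω)

/-- Cumulated cost `∑_{t=1}^T U(x₁, u_{2,i}(t))` of the fixed strategy `x₁`. -/
def fixedCost [MeasurableSpace Ω] (N₁ : Network E₁ E₂ n₁ n₂ d)
    (p₂ : Iterates Ω E₂ n₂ d) (P : Measure Ω) (ξ : Ω → (Fin d → ℝ)) (i : Fin n₁) (T : ℕ)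
    (x₁ : E₁) (ω : Ω) : ℝ :=
  ∑ t ∈ Finset.Icc 1 T, N₁.avgCost P ξ x₁ (N₁.u p₂ t i ω)

/-- Pseudo regret of agent `i` of the first network up to time `T`. -/
def pseudoRegret [MeasurableSpace Ω] (N₁ : Network E₁ E₂ n₁ n₂ d) (p₁ : Iterates Ω E₁ n₁ d)
    (p₂ : Iterates Ω E₂ n₂ d) (P : Measure Ω) (ξ : Ω → (Fin d → ℝ)) (i : Fin n₁) (T : ℕ) : ℝ :=
  (∫ ω, playedCost N₁ p₁ p₂ P ξ i T ω ∂P) -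
    sInf ((fun x₁ => ∫ ω, fixedCost N₁ p₂ P ξ i T x₁ ω ∂P) '' N₁.X)

/-- The expectations and the minimum in the definition of the pseudo regret exist. -/
def RegretExists [MeasurableSpace Ω] (N₁ : Network E₁ E₂ n₁ n₂ d) (p₁ : Iterates Ω E₁ n₁ d)
    (p₂ : Iterates Ω E₂ n₂ d) (P : Measure Ω) (ξ : Ω → (Fin d → ℝ)) (i : Fin n₁) (T : ℕ) : Prop :=
  Integrable (playedCost N₁ p₁ p₂ P ξ i T) P ∧
  (∀ x₁ ∈ N₁.X, Integrable (fixedCost N₁ p₂ P ξ i T x₁) P) ∧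
  ∃ z ∈ N₁.X, IsMinOn (fun x₁ => ∫ ω, fixedCost N₁ p₂ P ξ i T x₁ ω ∂P) N₁.X z

end TwoNetworks

/-- With step sizes `α`, the pseudo regret of every agent of the first network is `O(rate T)`, with a
constant that depends only on the displayed parameters: the sizes and connectivity of the networks,
the Lipschitz constant, the noise levels, the bounds on the initial points, the Bregman diameter of
the first strategy set, and the step sizes. -/
def RegretOrder (n₁ n₂ B₁ B₂ : ℕ) (η L ν₁ ν₂ Λ₁ Λ₂ R : ℝ) (α rate : ℕ → ℝ) : Prop :=
  ∃ C : ℝ, ∀ (d : ℕ)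
    (E₁ : Type u) [NormedAddCommGroup E₁] [NormedSpace ℝ E₁] [FiniteDimensional ℝ E₁]
    [MeasurableSpace E₁] [BorelSpace E₁]
    (E₂ : Type v) [NormedAddCommGroup E₂] [NormedSpace ℝ E₂] [FiniteDimensional ℝ E₂]
    [MeasurableSpace E₂] [BorelSpace E₂]
    (Ω : Type w) [MeasurableSpace Ω] (P : Measure Ω) [IsProbabilityMeasure P]
    (ξ : Ω → (Fin d → ℝ))
    (N₁ : Network E₁ E₂ n₁ n₂ d) (N₂ : Network E₂ E₁ n₂ n₁ d)
    (p₁ : Iterates Ω E₁ n₁ d) (p₂ : Iterates Ω E₂ n₂ d),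
    IsGameRun N₁ N₂ p₁ p₂ P ξ B₁ B₂ η L ν₁ ν₂ Λ₁ Λ₂ R α →
    ∀ (i : Fin n₁) (T : ℕ), 1 ≤ T →
      RegretExists N₁ p₁ p₂ P ξ i T ∧ pseudoRegret N₁ p₁ p₂ P ξ i T ≤ C * rate T

end

end DSMD

/-! Fix a comparator `z`. Optimality of a proximal step gives the three-point inequality, and with
1-strong convexity it yields α⟨ĝ, v - z⟩ ≤ D(z, v) - D(z, x⁺) + α²‖ĝ‖²/2. Sum this over the agents.
Since D(z, ·) is convex and the weights are doubly stochastic, averaging does not increase the total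
divergence, so ∑ D(z, v_j(t)) ≤ ∑ D(z, x_j(t)). Divide by α(t) and sum by parts: the linearized
regret of the network is at most n R / α(T) + ½ ∑ α(t) ∑ ‖ĝ_j(t)‖² (`IsRun.sum_gHat_apply_le`).

In expectation ĝ may be replaced by the true subgradient g, because v(t) is known at time t; this
requires the iterates to be adapted, hence the measurability of the argmin
(`measurable_of_unique_minimizer`). The Lipschitz condition and the variance bound give 𝔼‖ĝ‖² ≤ 2L²
+ 2ν². The subgradients live at the points (v_j, u_j), whereas the regret of agent i is evaluated at
(x_i, u_i); passing from one to the other costs only disagreements inside the two networks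
(`IsRun.mul_avgCost_sub_le`).

The disagreement is small because n windows of joint connectivity multiply to a stochastic matrix
with all entries at least η^(nB), which contracts disagreement by 1 - η^(nB)
(`IsMixing.pow_le_transition`, `disagreement_mul_le`), while each mirror step perturbs the averaging
by at most α‖ĝ‖. Summed over time this gives O(1 + ∑ α(t)) = O(√T). The remaining term R / α(T) = R
T^(1/2+ε) sets the rate. -/

namespace DSMD

/-! ### Bregman divergences and the proximal step -/

section Prox

variable {E : Type u} [NormedAddCommGroup E] [NormedSpace ℝ E] {X : Set E} {ψ : E → ℝ}

/-- On a convex set, the derivative relative to the set is the limit of difference quotients along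
segments. -/
theorem tendsto_fderivWithin_segment (hX : Convex ℝ X) (hψ : DifferentiableOn ℝ ψ X) {p x : E}
    (hp : p ∈ X) (hx : x ∈ X) :
    Tendsto (fun k : ℕ => ((k : ℝ) + 1) *
        (ψ (p + (1 / ((k : ℝ) + 1)) • (x - p)) - ψ p)) atTop
      (𝓝 (fderivWithin ℝ ψ X p (x - p))) := by
  have h := (hψ p hp).hasFDerivWithinAt
  refine h.lim (l := atTop) (c := fun k : ℕ => (k : ℝ) + 1)
    (d := fun k : ℕ => (1 / ((k : ℝ) + 1)) • (x - p)) (v := x - p) ?_ ?_ ?_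
  · simpa using (tendsto_one_div_add_atTop_nhds_zero_nat (𝕜 := ℝ)).smul_const (x - p)
  · refine Eventually.of_forall fun k => hX.add_smul_sub_mem hp hx ⟨by positivity, ?_⟩
    rw [div_le_one (by positivity)]
    have : (0 : ℝ) ≤ k := k.cast_nonneg
    linarith
  · refine tendsto_const_nhds.congr fun k => ?_
    have : (k : ℝ) + 1 ≠ 0 := by positivity
    rw [smul_smul, mul_one_div_cancel this, one_smul]

/-- Strong convexity on the segment from `p` to `x`, divided by the parameter s and passed to the
limit s → 0. -/
theorem half_sq_norm_le_bregman (hψ : IsRegularizer X ψ) {p x : E} (hp : p ∈ X) (hx : x ∈ X) :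
    1 / 2 * ‖x - p‖ ^ 2 ≤ bregman X ψ x p := by
  have hX : Convex ℝ X := hψ.strong.1
  have hlim := tendsto_fderivWithin_segment hX hψ.diff hp hx
  have hs := (tendsto_one_div_add_atTop_nhds_zero_nat (𝕜 := ℝ))
  have hR : Tendsto (fun k : ℕ => ψ x - ψ p - (1 - 1 / ((k : ℝ) + 1)) * (1 / 2 * ‖x - p‖ ^ 2))
      atTop (𝓝 (ψ x - ψ p - (1 - 0) * (1 / 2 * ‖x - p‖ ^ 2))) :=
    tendsto_const_nhds.sub ((tendsto_const_nhds.sub hs).mul_const _)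
  have := le_of_tendsto_of_tendsto' hlim hR fun k => by
    set s : ℝ := 1 / ((k : ℝ) + 1) with hs
    have hk : (0 : ℝ) < (k : ℝ) + 1 := by positivity
    have hks : ((k : ℝ) + 1) * s = 1 := by rw [hs]; field_simp
    have hs0 : 0 ≤ s := by positivity
    have hs1 : s ≤ 1 := by
      rw [hs, div_le_one hk]
      have : (0 : ℝ) ≤ k := k.cast_nonneg
      linarith
    have h := hψ.strong.2 hp hx (sub_nonneg.2 hs1) hs0 (by ring)
    have he : (1 - s) • p + s • x = p + s • (x - p) := by module
    rw [he, norm_sub_rev p x] at h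
    simp only [smul_eq_mul] at h
    calc ((k : ℝ) + 1) * (ψ (p + s • (x - p)) - ψ p)
        ≤ ((k : ℝ) + 1) * (s * (ψ x - ψ p - (1 - s) * (1 / 2 * ‖x - p‖ ^ 2))) := by
          refine mul_le_mul_of_nonneg_left ?_ hk.le
          linarith
      _ = ψ x - ψ p - (1 - s) * (1 / 2 * ‖x - p‖ ^ 2) := by
          rw [← mul_assoc, hks, one_mul]
  unfold bregman
  linarith

theorem bregman_nonneg (hψ : IsRegularizer X ψ) {p x : E} (hp : p ∈ X) (hx : x ∈ X) :
    0 ≤ bregman X ψ x p :=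
  le_trans (by positivity) (half_sq_norm_le_bregman hψ hp hx)

/-- Three-point inequality for the proximal step. -/
theorem IsProx.three_point (hψ : IsRegularizer X ψ) {p z x : E} {y : E →L[ℝ] ℝ}
    (hz : IsProx X ψ p y z) (hx : x ∈ X) :
    y (x - z) + bregman X ψ x z + bregman X ψ z p ≤ bregman X ψ x p := by
  have hX : Convex ℝ X := hψ.strong.1
  have hlim := tendsto_fderivWithin_segment hX hψ.diff hz.1 hx
  -- First-order optimality of `z`: moving from `z` towards `x` by a fraction s does not lower the
  -- objective. All terms but ψ are affine, so after division by s only the difference quotient of ψ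
  -- at `z` needs a limit.
  have key : y (x - z) + fderivWithin ℝ ψ X p (x - z) ≤ fderivWithin ℝ ψ X z (x - z) := by
    refine ge_of_tendsto' hlim fun k => ?_
    set s : ℝ := 1 / ((k : ℝ) + 1) with hs
    have hk : (0 : ℝ) < (k : ℝ) + 1 := by positivity
    have hks : ((k : ℝ) + 1) * s = 1 := by rw [hs]; field_simp
    have hs1 : s ≤ 1 := by
      rw [hs, div_le_one hk]
      have : (0 : ℝ) ≤ k := k.cast_nonneg
      linarith
    have hmem : z + s • (x - z) ∈ X := hX.add_smul_sub_mem hz.1 hx ⟨by positivity, hs1⟩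
    have h := hz.2 hmem
    simp only [Set.mem_ofPred_eq, bregman, map_sub, map_add, map_smul, smul_eq_mul] at h
    rw [map_sub, map_sub]
    calc _ = ((k : ℝ) + 1) * (s * (y x - y z +
            (fderivWithin ℝ ψ X p x - fderivWithin ℝ ψ X p z))) := by
          rw [← mul_assoc, hks, one_mul]
      _ ≤ _ := by
          refine mul_le_mul_of_nonneg_left ?_ hk.le
          linarith
  simp only [bregman, map_sub] at key ⊢
  linarith

/-- In the three-point inequality with comparator `p`, both D(p, z) and D(z, p) are at least ½‖z -
p‖², so together they give ‖z - p‖² ≤ ‖y‖ ‖z - p‖. -/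
theorem IsProx.norm_sub_le (hψ : IsRegularizer X ψ) {p z : E} {y : E →L[ℝ] ℝ} (hp : p ∈ X)
    (hz : IsProx X ψ p y z) : ‖z - p‖ ≤ ‖y‖ := by
  have h := hz.three_point hψ hp
  have h1 := half_sq_norm_le_bregman hψ hp hz.1
  have h2 := half_sq_norm_le_bregman hψ hz.1 hp
  have h3 : bregman X ψ p p = 0 := by simp [bregman]
  have h4 : -(y (p - z)) ≤ ‖y‖ * ‖z - p‖ := by
    rw [← map_neg, neg_sub]
    exact (le_abs_self _).trans (y.le_opNorm _)
  rw [norm_sub_rev p z] at h2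
  have h5 : ‖z - p‖ * ‖z - p‖ ≤ ‖y‖ * ‖z - p‖ := by nlinarith
  rcases (norm_nonneg (z - p)).eq_or_lt with h0 | h0
  · rw [← h0]; positivity
  · exact le_of_mul_le_mul_right h5 h0

/-- One step of mirror descent: regret of the linearized cost in terms of the decrease of the
divergence to the comparator. -/
theorem IsProx.linear_regret_le (hψ : IsRegularizer X ψ) {p z x : E} {y : E →L[ℝ] ℝ} (hp : p ∈ X)
    (hz : IsProx X ψ p (-y) z) (hx : x ∈ X) :
    y (p - x) ≤ bregman X ψ x p - bregman X ψ x z + 1 / 2 * ‖y‖ ^ 2 := by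
  have h := hz.three_point hψ hx
  have h1 := half_sq_norm_le_bregman hψ hp hz.1
  have h4 : y (p - z) ≤ ‖y‖ * ‖z - p‖ := by
    rw [norm_sub_rev]
    exact (le_abs_self _).trans (y.le_opNorm _)
  have h5 := sq_nonneg (‖y‖ - ‖z - p‖)
  simp only [neg_apply, map_sub] at h h4 ⊢
  nlinarith

end Prox

/-! ### Measurability of minimizers -/

section Measurability

theorem measurable_comp_of_continuousOn {E : Type u} [TopologicalSpace E] [MeasurableSpace E]
    [BorelSpace E] {X : Set E} {Ω : Type w} {mΩ : MeasurableSpace Ω} {f : E → ℝ} (hf : ContinuousOn f X)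
    {v : Ω → E} (hv : Measurable v) (hvX : ∀ ω, v ω ∈ X) : Measurable fun ω => f (v ω) :=
  (continuousOn_iff_continuous_domRestrict.1 hf).measurable.comp
    (hv.subtype_mk (h := hvX))

theorem exists_lt_add_of_subset_closure {E : Type u} [TopologicalSpace E] {A S : Set E} {f : E → ℝ}
    (hf : ContinuousOn f S) (hA : A ⊆ S) (hS : S ⊆ closure A) {z : E} (hz : z ∈ S) {c : ℝ}
    (hc : f z < c) : ∃ a ∈ A, f a < c := by
  have h1 : ∀ᶠ x in 𝓝[A] z, f x < c := ((hf z hz).mono hA).eventually_lt_const hc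
  have : (𝓝[A] z).NeBot := mem_closure_iff_nhdsWithin_neBot.1 (hS hz)
  obtain ⟨a, ha, haA⟩ := (h1.and self_mem_nhdsWithin).exists
  exact ⟨a, haA, ha⟩

variable {E : Type u} [NormedAddCommGroup E] [NormedSpace ℝ E] [FiniteDimensional ℝ E]
  [MeasurableSpace E] [BorelSpace E] {X : Set E} {Ω : Type w} {mΩ : MeasurableSpace Ω}

/-- The unique minimizer over a compact set of a function that is continuous in the variable and
measurable in the parameter depends measurably on the parameter. -/
theorem measurable_of_unique_minimizer (hX : IsCompact X) {Φ : E → Ω → ℝ}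
    (hcont : ∀ ω, ContinuousOn (fun x => Φ x ω) X) (hmeas : ∀ x ∈ X, Measurable (Φ x))
    {z : Ω → E} (hz : ∀ ω, z ω ∈ X) (hmin : ∀ ω, ∀ x ∈ X, Φ x ω ≤ Φ (z ω) ω → x = z ω) :
    Measurable z := by
  refine measurable_of_isClosed fun K hK => ?_
  obtain ⟨A, hAK, hAc, hAd⟩ :=
    (TopologicalSpace.IsSeparable.of_separableSpace (X ∩ K)).exists_countable_dense_subset
  obtain ⟨D, hDX, hDc, hDd⟩ :=
    (TopologicalSpace.IsSeparable.of_separableSpace X).exists_countable_dense_subset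
  -- The minimizer lies in `K` iff the infimum over X ∩ K does not exceed the infimum over X. By
  -- continuity both may be tested on countable dense subsets, with slack 1/(k+1).
  have hset : z ⁻¹' K = ⋂ k : ℕ, ⋃ q ∈ A, ⋂ p ∈ D, {ω | Φ q ω < Φ p ω + 1 / ((k : ℝ) + 1)} := by
    ext ω
    simp only [Set.mem_preimage, Set.mem_iInter, Set.mem_iUnion, Set.mem_ofPred_eq, exists_prop]
    have hle : ∀ x ∈ X, Φ (z ω) ω ≤ Φ x ω := fun x hx => by
      by_contra! h
      exact absurd (hmin ω x hx h.le ▸ h) (lt_irrefl _)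
    constructor
    · intro hzK k
      have hk : (0 : ℝ) < 1 / ((k : ℝ) + 1) := by positivity
      obtain ⟨q, hq, hlt⟩ := exists_lt_add_of_subset_closure ((hcont ω).mono Set.inter_subset_left)
        hAK hAd ⟨hz ω, hzK⟩ (lt_add_of_pos_right (Φ (z ω) ω) hk)
      exact ⟨q, hq, fun p hp => by linarith [hle p (hDX hp)]⟩
    · intro h
      obtain ⟨q₀, hq₀, -⟩ := h 0
      obtain ⟨q, hq, hqmin⟩ := (hX.inter_right hK).exists_isMinOn ⟨q₀, hAK hq₀⟩
        ((hcont ω).mono Set.inter_subset_left)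
      -- The minimum over X ∩ K exceeds the minimum over X by less than any ε: half of ε pays for
      -- the slack 1/(k+1), half for approximating `z ω` from `D`. Uniqueness then identifies the
      -- two minimizers.
      have : q = z ω := by
        refine hmin ω q hq.1 (le_of_forall_pos_lt_add fun ε hε => ?_)
        obtain ⟨k, hk⟩ := exists_nat_one_div_lt (half_pos hε)
        obtain ⟨r, hr, hrD⟩ := h k
        obtain ⟨p, hp, hpz⟩ := exists_lt_add_of_subset_closure (hcont ω) hDX hDd (hz ω)
          (lt_add_of_pos_right (Φ (z ω) ω) (half_pos hε))
        have h1 := hrD p hp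
        have h2 : Φ q ω ≤ Φ r ω := hqmin (hAK hr)
        linarith
      exact this ▸ hq.2
  rw [hset]
  refine MeasurableSet.iInter fun k => MeasurableSet.biUnion hAc fun q hq =>
    MeasurableSet.biInter hDc fun p hp => measurableSet_lt (hmeas q (hAK hq).1)
      ((hmeas p (hDX hp)).add_const _)

theorem IsProx.measurable {ψ : E → ℝ} (hX : IsCompact X) (hψ : IsRegularizer X ψ)
    {v z : Ω → E} {y : Ω → E →L[ℝ] ℝ} (hv : Measurable v) (hvX : ∀ ω, v ω ∈ X)
    (hy : StronglyMeasurable y)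
    (hz : ∀ ω, IsProx X ψ (v ω) (y ω) (z ω)) : Measurable z := by
  have hψc := hψ.diff.continuousOn
  have hXc := hψ.strong.1
  refine measurable_of_unique_minimizer hX
    (Φ := fun x ω => y ω (v ω - x) + bregman X ψ x (v ω)) ?_ ?_ (fun ω => (hz ω).1) ?_
  · intro ω
    unfold bregman
    fun_prop
  · intro x hx
    have hψv : Measurable fun ω => ψ (v ω) := measurable_comp_of_continuousOn hψc hv hvX
    -- The derivative at the random point is a pointwise limit of difference quotients, each of
    -- which involves only values of ψ.
    have hlim : Measurable fun ω => fderivWithin ℝ ψ X (v ω) (x - v ω) := by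
      refine measurable_of_tendsto_metrizable (f := fun (k : ℕ) ω => ((k : ℝ) + 1) *
        (ψ (v ω + (1 / ((k : ℝ) + 1)) • (x - v ω)) - ψ (v ω))) (fun k => ?_)
        (tendsto_pi_nhds.2 fun ω => tendsto_fderivWithin_segment hXc hψ.diff (hvX ω) hx)
      refine ((measurable_comp_of_continuousOn hψc
        (v := fun ω => v ω + (1 / ((k : ℝ) + 1)) • (x - v ω)) (by fun_prop) fun ω => ?_).sub
          hψv).const_mul _
      refine hXc.add_smul_sub_mem (hvX ω) hx ⟨by positivity, ?_⟩
      rw [div_le_one (by positivity)]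
      have : (0 : ℝ) ≤ k := k.cast_nonneg
      linarith
    have hyx : StronglyMeasurable fun ω => y ω (v ω - x) :=
      isBoundedBilinearMap_apply.continuous.comp_stronglyMeasurable
        (hy.prodMk (hv.sub_const x).stronglyMeasurable)
    exact hyx.measurable.add ((measurable_const.sub hψv).sub hlim)
  -- Uniqueness: the three-point inequality bounds D(x, z) by the gap in the objective, which is
  -- nonpositive here.
  · intro ω x hx hle
    have h := (hz ω).three_point hψ hx
    have h1 := half_sq_norm_le_bregman hψ (hz ω).1 hx
    simp only [map_sub] at h hle
    have h2 : ‖x - z ω‖ ^ 2 ≤ 0 := by linarith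
    rw [← sub_eq_zero, ← norm_eq_zero]
    nlinarith [norm_nonneg (x - z ω)]

end Measurability

/-! ### Products of weight matrices -/

section Transition

variable {n : ℕ} {edge : ℕ → Fin n → Fin n → Prop} {W : ℕ → Matrix (Fin n) (Fin n) ℝ} {η : ℝ}
  {B : ℕ}

theorem IsMixing.weight_nonneg (h : IsMixing edge W η B) (hη : 0 < η) (t : ℕ) (i j : Fin n) :
    0 ≤ W t i j := by
  by_cases he : edge t j i
  · exact hη.le.trans (h.weight_ge t i j he)
  · exact (h.weight_zero t i j he).ge

/-- The product `W (s + k - 1) ⋯ W s` of the weight matrices over `k` steps from time `s` on. -/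
def transition (W : ℕ → Matrix (Fin n) (Fin n) ℝ) (s : ℕ) : ℕ → Matrix (Fin n) (Fin n) ℝ
  | 0 => 1
  | k + 1 => W (s + k) * transition W s k

theorem IsMixing.transition_nonneg (h : IsMixing edge W η B) (hη : 0 < η) (s k : ℕ) (i j : Fin n) :
    0 ≤ transition W s k i j := by
  induction k generalizing i with
  | zero =>
    simp only [transition, Matrix.one_apply]
    split_ifs <;> norm_num
  | succ k ih =>
    simp only [transition, Matrix.mul_apply]
    exact Finset.sum_nonneg fun a _ => mul_nonneg (h.weight_nonneg hη _ _ _) (ih a)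

theorem IsMixing.transition_row_sum (h : IsMixing edge W η B) (s k : ℕ) (i : Fin n) :
    ∑ j, transition W s k i j = 1 := by
  induction k generalizing i with
  | zero => simp [transition, Matrix.one_apply]
  | succ k ih =>
    simp only [transition, Matrix.mul_apply]
    rw [Finset.sum_comm]
    simp_rw [← Finset.mul_sum, ih, mul_one]
    exact h.row_sum _ i

theorem IsMixing.pow_le_transition_succ (h : IsMixing edge W η B) (hη : 0 < η) {s k : ℕ}
    {a i j : Fin n} (ha : η ^ k ≤ transition W s k a j) (he : edge (s + k) a i) :
    η ^ (k + 1) ≤ transition W s (k + 1) i j := by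
  simp only [transition, Matrix.mul_apply]
  calc η ^ (k + 1) = η * η ^ k := pow_succ' η k
    _ ≤ W (s + k) i a * transition W s k a j :=
        mul_le_mul (h.weight_ge _ _ _ he) ha (by positivity) (h.weight_nonneg hη _ _ _)
    _ ≤ _ := Finset.single_le_sum (f := fun a => W (s + k) i a * transition W s k a j)
        (fun b _ => mul_nonneg (h.weight_nonneg hη _ _ _) (h.transition_nonneg hη _ _ _ _))
        (Finset.mem_univ a)

/-- Over `n` windows of joint connectivity, every agent influences every other one. -/
theorem IsMixing.pow_le_transition (h : IsMixing edge W η B) (hη : 0 < η) (s : ℕ) (i j : Fin n) :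
    η ^ (n * B) ≤ transition W s (n * B) i j := by
  classical
  -- `S k` collects agents on which `j` has weight at least η^k after k steps. Loops make it
  -- increasing. If it stalls over a whole window, it is closed under the edges of that window,
  -- hence everything by connectivity; otherwise each window adds an agent.
  let S : ℕ → Finset (Fin n) := fun k => {i | η ^ k ≤ transition W s k i j}
  have hmemS : ∀ k i, i ∈ S k ↔ η ^ k ≤ transition W s k i j := fun k i => by simp [S]
  have hstep : ∀ k a b, a ∈ S k → edge (s + k) a b → b ∈ S (k + 1) := fun k a b ha he =>
    (hmemS _ _).2 (h.pow_le_transition_succ hη ((hmemS _ _).1 ha) he)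
  have hmono : Monotone S := monotone_nat_of_le_succ fun k a ha => hstep k a a ha (h.self_loop _ _)
  have hj : ∀ k, j ∈ S k := fun k => hmono (Nat.zero_le k) ((hmemS _ _).2 (by simp [transition]))
  have hgrow : ∀ k, S (k + B) = S k → S k = Finset.univ := by
    intro k hk
    refine Finset.eq_univ_iff_forall.2 fun b => ?_
    have hc := h.connected (s + k) j b
    induction hc with
    | refl => exact hj k
    | @tail a b _ hab ih =>
      obtain ⟨t, ht1, ht2, he⟩ := hab
      obtain ⟨l, rfl⟩ := Nat.exists_eq_add_of_le ht1
      have h1 : a ∈ S (k + l) := hmono (Nat.le_add_right _ _) ih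
      have h2 : b ∈ S (k + l + 1) := hstep _ a b h1 (by rwa [← add_assoc])
      exact hk ▸ hmono (by omega : k + l + 1 ≤ k + B) h2
  have hcard : ∀ m, m ≤ n → m ≤ (S (m * B)).card := by
    intro m
    induction m with
    | zero => simp
    | succ m ih =>
      intro hm
      have h1 := ih (by omega)
      have hsub : S (m * B) ⊆ S (m * B + B) := hmono (Nat.le_add_right _ _)
      rw [Nat.succ_mul]
      by_cases he : S (m * B + B) = S (m * B)
      · rw [he, hgrow _ he]
        simpa using hm
      · have := Finset.card_lt_card (hsub.ssubset_of_ne (Ne.symm he))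
        omega
  have huniv : S (n * B) = Finset.univ :=
    Finset.eq_univ_of_card _ (le_antisymm (Finset.card_le_univ _) (by simpa using hcard n le_rfl))
  exact (hmemS _ _).1 (huniv ▸ Finset.mem_univ i)

end Transition

/-! ### Contraction of disagreement -/

section Disagreement

variable {E : Type u} [NormedAddCommGroup E] {n : ℕ}

/-- The largest distance between the strategies of two agents. -/
noncomputable def disagreement (x : Fin n → E) : ℝ :=
  ‖fun ij : Fin n × Fin n => x ij.1 - x ij.2‖

theorem disagreement_nonneg (x : Fin n → E) : 0 ≤ disagreement x := norm_nonneg _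

theorem norm_sub_le_disagreement (x : Fin n → E) (i j : Fin n) : ‖x i - x j‖ ≤ disagreement x :=
  norm_le_pi_norm (fun ij : Fin n × Fin n => x ij.1 - x ij.2) (i, j)

theorem disagreement_le {x : Fin n → E} {c : ℝ} (hc : 0 ≤ c) (h : ∀ i j, ‖x i - x j‖ ≤ c) :
    disagreement x ≤ c :=
  (pi_norm_le_iff_of_nonneg hc).2 fun ij => h ij.1 ij.2

variable [NormedSpace ℝ E]

/-- Couple the two weight families by their product: r times the difference equals ∑ a_i b_j (x_i -
x_j), of total mass r². -/
theorem norm_weighted_sub_le (x : Fin n → E) {a b : Fin n → ℝ} {r : ℝ} (ha : ∀ i, 0 ≤ a i)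
    (hb : ∀ i, 0 ≤ b i) (har : ∑ i, a i = r) (hbr : ∑ i, b i = r) :
    ‖∑ i, a i • x i - ∑ i, b i • x i‖ ≤ r * disagreement x := by
  have hr : 0 ≤ r := har ▸ Finset.sum_nonneg fun i _ => ha i
  rcases hr.eq_or_lt with h0 | h0
  · have ha0 : ∀ i, a i = 0 := fun i =>
      (Finset.sum_eq_zero_iff_of_nonneg fun i _ => ha i).1 (har.trans h0.symm) i (Finset.mem_univ i)
    have hb0 : ∀ i, b i = 0 := fun i =>
      (Finset.sum_eq_zero_iff_of_nonneg fun i _ => hb i).1 (hbr.trans h0.symm) i (Finset.mem_univ i)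
    simp [ha0, hb0, ← h0]
  · have he : r • (∑ i, a i • x i - ∑ i, b i • x i) = ∑ i, ∑ j, (a i * b j) • (x i - x j) := by
      simp_rw [smul_sub, Finset.sum_sub_distrib]
      congr 1
      · rw [Finset.smul_sum]
        refine Finset.sum_congr rfl fun i _ => ?_
        rw [← Finset.sum_smul, ← Finset.mul_sum, hbr, smul_smul, mul_comm]
      · rw [Finset.sum_comm, Finset.smul_sum]
        refine Finset.sum_congr rfl fun i _ => ?_
        rw [← Finset.sum_smul, ← Finset.sum_mul, har, smul_smul]
    have h1 : r * ‖∑ i, a i • x i - ∑ i, b i • x i‖ ≤ r * (r * disagreement x) := by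
      calc r * ‖∑ i, a i • x i - ∑ i, b i • x i‖ = ‖∑ i, ∑ j, (a i * b j) • (x i - x j)‖ := by
            rw [← he, norm_smul, Real.norm_of_nonneg hr]
        _ ≤ ∑ i, ∑ j, (a i * b j) * disagreement x := by
            refine norm_sum_le_of_le _ fun i _ => norm_sum_le_of_le _ fun j _ => ?_
            rw [norm_smul, Real.norm_of_nonneg (mul_nonneg (ha i) (hb j))]
            exact mul_le_mul_of_nonneg_left (norm_sub_le_disagreement x i j)
              (mul_nonneg (ha i) (hb j))
        _ = r * (r * disagreement x) := by
            simp_rw [← Finset.sum_mul, ← Finset.mul_sum, hbr, ← Finset.sum_mul, har]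
            ring
    exact le_of_mul_le_mul_left h1 h0

/-- A stochastic matrix with all entries at least `δ` contracts the disagreement. -/
theorem disagreement_mul_le {A : Matrix (Fin n) (Fin n) ℝ} {δ : ℝ} (hδ : 0 ≤ δ)
    (hA : ∀ i j, δ ≤ A i j) (hrow : ∀ i, ∑ j, A i j = 1) (x : Fin n → E) (i j : Fin n) :
    ‖∑ k, A i k • x k - ∑ k, A j k • x k‖ ≤ (1 - δ) * disagreement x := by
  classical
  -- Both rows put mass at least δ on the single column `i`. Removing it from each cancels in the
  -- difference and leaves nonnegative weights of total 1 - δ.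
  have hnn : ∀ a k : Fin n, 0 ≤ A a k - if k = i then δ else 0 := fun a k => by
    split_ifs
    · linarith [hA a k]
    · linarith [hA a k]
  have hsum : ∀ a : Fin n, ∑ k, (A a k - if k = i then δ else 0) = 1 - δ := fun a => by
    simp [Finset.sum_sub_distrib, hrow]
  have h := norm_weighted_sub_le x (hnn i) (hnn j) (hsum i) (hsum j)
  simpa [sub_smul, Finset.sum_sub_distrib] using h

variable {edge : ℕ → Fin n → Fin n → Prop} {W : ℕ → Matrix (Fin n) (Fin n) ℝ} {η : ℝ} {B : ℕ}

/-- Past errors are only averaged by later stochastic matrices, so they accumulate without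
amplification. -/
theorem IsMixing.norm_sub_transition_le (h : IsMixing edge W η B) (hη : 0 < η)
    {x : ℕ → Fin n → E} {e : ℕ → ℝ} (hx : ∀ t i, ‖x (t + 1) i - ∑ j, W t i j • x t j‖ ≤ e t)
    (s k : ℕ) (i : Fin n) :
    ‖x (s + k) i - ∑ j, transition W s k i j • x s j‖ ≤ ∑ l ∈ Finset.range k, e (s + l) := by
  induction k generalizing i with
  | zero => simp [transition, Matrix.one_apply]
  | succ k ih =>
    have he : x (s + (k + 1)) i - ∑ j, transition W s (k + 1) i j • x s j =
        (∑ a, W (s + k) i a • (x (s + k) a - ∑ j, transition W s k a j • x s j)) +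
          (x (s + k + 1) i - ∑ j, W (s + k) i j • x (s + k) j) := by
      have : ∑ j, transition W s (k + 1) i j • x s j =
          ∑ a, W (s + k) i a • ∑ j, transition W s k a j • x s j := by
        simp only [transition, Matrix.mul_apply, Finset.sum_smul, Finset.smul_sum, smul_smul]
        exact Finset.sum_comm
      rw [this]
      simp only [smul_sub, Finset.sum_sub_distrib]
      rw [← add_assoc s k 1]
      abel
    rw [he, Finset.sum_range_succ]
    refine (norm_add_le _ _).trans (add_le_add ?_ (hx _ _))
    calc _ ≤ ∑ a, W (s + k) i a * ∑ l ∈ Finset.range k, e (s + l) := by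
          refine norm_sum_le_of_le _ fun a _ => ?_
          rw [norm_smul, Real.norm_of_nonneg (h.weight_nonneg hη _ _ _)]
          exact mul_le_mul_of_nonneg_left (ih a) (h.weight_nonneg hη _ _ _)
      _ = _ := by rw [← Finset.sum_mul, h.row_sum, one_mul]

theorem IsMixing.disagreement_add_le (h : IsMixing edge W η B) (hη : 0 < η)
    {x : ℕ → Fin n → E} {e : ℕ → ℝ} (hx : ∀ t i, ‖x (t + 1) i - ∑ j, W t i j • x t j‖ ≤ e t)
    {δ : ℝ} (hδ : 0 ≤ δ) (s k : ℕ) (hT : ∀ i j, δ ≤ transition W s k i j) (hn : 0 < n) :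
    disagreement (x (s + k)) ≤
      (1 - δ) * disagreement (x s) + 2 * ∑ l ∈ Finset.range k, e (s + l) := by
  have key : ∀ i j, ‖x (s + k) i - x (s + k) j‖ ≤
      (1 - δ) * disagreement (x s) + 2 * ∑ l ∈ Finset.range k, e (s + l) := fun i j => by
    have h1 := h.norm_sub_transition_le hη hx s k i
    have h2 := h.norm_sub_transition_le hη hx s k j
    have h3 := disagreement_mul_le hδ hT (h.transition_row_sum s k) (x s) i j
    have h4 : x (s + k) i - x (s + k) j =
        (x (s + k) i - ∑ a, transition W s k i a • x s a) -
        (x (s + k) j - ∑ a, transition W s k j a • x s a) +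
        (∑ a, transition W s k i a • x s a - ∑ a, transition W s k j a • x s a) := by abel
    rw [h4]
    refine (norm_add_le _ _).trans ?_
    have := norm_sub_le (x (s + k) i - ∑ a, transition W s k i a • x s a)
      (x (s + k) j - ∑ a, transition W s k j a • x s a)
    linarith
  exact disagreement_le ((norm_nonneg _).trans (key ⟨0, hn⟩ ⟨0, hn⟩)) key

end Disagreement

/-- Summation of a sequence that contracts over windows of length `M`, up to antitone errors. -/
theorem mul_sum_le_of_window_contraction {d α : ℕ → ℝ} {δ K : ℝ} {M : ℕ} (hd : ∀ t, 0 ≤ d t)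
    (hstart : ∀ k, d k ≤ d 0 + 2 * (k * (K * α 0)))
    (hcontr : ∀ s, d (s + M) ≤ (1 - δ) * d s + 2 * (M * (K * α s))) (hK : 0 ≤ K * α 0) (T : ℕ) :
    δ * ∑ t ∈ Finset.range T, d t ≤
      M * (d 0 + 2 * (M * (K * α 0))) + 2 * (M * (K * ∑ t ∈ Finset.range T, α t)) := by
  -- Split the sum over M + T terms: the first M are bounded crudely, the shifted ones by (1 - δ)
  -- times the original sum, which is then absorbed on the left.
  have h1 : ∑ t ∈ Finset.range T, d t ≤ ∑ t ∈ Finset.range (M + T), d t :=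
    Finset.sum_le_sum_of_subset_of_nonneg (Finset.range_mono (Nat.le_add_left _ _))
      fun t _ _ => hd t
  have h2 : ∑ t ∈ Finset.range M, d t ≤ M * (d 0 + 2 * (M * (K * α 0))) := by
    rw [← nsmul_eq_mul]
    have h : ∀ t ∈ Finset.range M, d t ≤ d 0 + 2 * (M * (K * α 0)) := fun t ht => by
      have : (t : ℝ) ≤ M := by exact_mod_cast (Finset.mem_range.1 ht).le
      have := mul_le_mul_of_nonneg_right this hK
      linarith [hstart t]
    simpa using Finset.sum_le_card_nsmul _ _ _ h
  have h3 : ∑ t ∈ Finset.range T, d (M + t) ≤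
      (1 - δ) * ∑ t ∈ Finset.range T, d t + 2 * (M * (K * ∑ t ∈ Finset.range T, α t)) := by
    simp only [Finset.mul_sum, ← Finset.sum_add_distrib]
    exact Finset.sum_le_sum fun t _ => by rw [add_comm M t]; exact hcontr t
  rw [Finset.sum_range_add] at h1
  linarith

theorem integrable_comp_of_continuousOn {E : Type u} [TopologicalSpace E] [MeasurableSpace E]
    [BorelSpace E] {X : Set E} (hX : IsCompact X) {f : E → ℝ} (hf : ContinuousOn f X)
    {Ω : Type w} [MeasurableSpace Ω] {P : Measure Ω} [IsFiniteMeasure P]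
    {v : Ω → E} (hv : Measurable v) (hvX : ∀ ω, v ω ∈ X) : Integrable (fun ω => f (v ω)) P := by
  obtain ⟨C, hC⟩ := hX.exists_bound_of_continuousOn hf
  exact Integrable.of_bound (measurable_comp_of_continuousOn hf hv hvX).aestronglyMeasurable C
    (Eventually.of_forall fun ω => hC _ (hvX ω))

/-! ### Subgradient moments and accumulated disagreement along a run -/

section Run

variable {Ω : Type w} [MeasurableSpace Ω]
  {E : Type u} [NormedAddCommGroup E] [NormedSpace ℝ E]
  {F : Type v} [NormedAddCommGroup F] [NormedSpace ℝ F] {n m d : ℕ}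
  {N : Network E F n m d} {p : Iterates Ω E n d} {q : Iterates Ω F m d} {P : Measure Ω}
  {ξ : Ω → (Fin d → ℝ)} {α : ℕ → ℝ} {ℱ : ℕ → MeasurableSpace Ω} {Y : Set F} {η L ν Λ : ℝ} {B : ℕ}

theorem IsRun.x_mem [MeasurableSpace E] (hr : IsRun N p q P ξ α ℱ) (t : ℕ) (i : Fin n) (ω : Ω) :
    p.x t i ω ∈ N.X := by
  cases t with
  | zero => exact hr.init_mem i ω
  | succ t => exact (hr.update t i ω).1

theorem IsRun.v_mem [MeasurableSpace E] (hr : IsRun N p q P ξ α ℱ)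
    (ha : N.IsAdmissible Y P ξ η B L) (hη : 0 < η) (t : ℕ) (i : Fin n) (ω : Ω) :
    N.v p t i ω ∈ N.X :=
  ha.X_convex.sum_mem (fun j _ => ha.mixing.weight_nonneg hη t i j) (ha.mixing.row_sum t i)
    fun j _ => hr.x_mem t j ω

theorem Network.IsAdmissible.u_mem (ha : N.IsAdmissible Y P ξ η B L) (hY : Convex ℝ Y)
    (hq : ∀ t j ω, q.x t j ω ∈ Y) (t : ℕ) (i : Fin n) (ω : Ω) : N.u q t i ω ∈ Y :=
  hY.sum_mem (fun j _ => ha.cross.nonneg t i j) (ha.cross.row_sum t i) fun j _ => hq t j ω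

/-- The iterates are adapted to the information. -/
theorem IsRun.measurable_x [FiniteDimensional ℝ E] [MeasurableSpace E] [BorelSpace E]
    (hr : IsRun N p q P ξ α ℱ) (ha : N.IsAdmissible Y P ξ η B L) (hη : 0 < η)
    (hmono : Monotone ℱ) (h0 : ∀ i, Measurable[ℱ 0] (p.x 0 i)) (t : ℕ) (i : Fin n) :
    Measurable[ℱ t] (p.x t i) := by
  induction t generalizing i with
  | zero => exact h0 i
  | succ t ih =>
    have hv : Measurable[ℱ (t + 1)] (N.v p t i) := by
      refine Finset.measurable_fun_sum _ fun j _ => ?_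
      exact ((ih j).mono (hmono (Nat.le_succ t)) le_rfl).const_smul (N.W t i j)
    exact IsProx.measurable ha.X_compact ha.regularizer hv (hr.v_mem ha hη t i)
      ((hr.gHat_meas t i).const_smul (α t)).neg (hr.update t i)

/-- As `N.O` is open, one can move a little from v in every direction, and the subgradient
inequality meets the Lipschitz bound. -/
theorem IsUnbiased.ae_norm_g_le [MeasurableSpace E] (hu : IsUnbiased N p q P ξ ν ℱ)
    (hr : IsRun N p q P ξ α ℱ) (ha : N.IsAdmissible Y P ξ η B L) (hη : 0 < η) (hL : 0 ≤ L)
    (hY : ∀ t i ω, N.u q t i ω ∈ Y) (t : ℕ) (i : Fin n) : ∀ᵐ ω ∂P, ‖p.g t i ω‖ ≤ L := by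
  filter_upwards [hu.g_sub t i] with ω hω
  have hv := ha.X_subset (hr.v_mem ha hη t i ω)
  obtain ⟨r, hr0, hball⟩ := Metric.isOpen_iff.1 ha.O_open _ hv
  have key : ∀ w : E, p.g t i ω w ≤ L * ‖w‖ := fun w => by
    -- This choice keeps s‖w‖ < r; the summand 1 covers w = 0.
    set s : ℝ := r / (2 * (‖w‖ + 1)) with hs
    have hs0 : 0 < s := by positivity
    have hnorm : ‖s • w‖ = s * ‖w‖ := by rw [norm_smul, Real.norm_of_nonneg hs0.le]
    have hmem : N.v p t i ω + s • w ∈ N.O := by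
      refine hball ?_
      rw [Metric.mem_ball, dist_eq_norm, add_sub_cancel_left, hnorm, hs, div_mul_eq_mul_div,
        div_lt_iff₀ (by positivity)]
      nlinarith [norm_nonneg w]
    have h1 := hω _ hmem
    have h2 := (abs_le.1 (ha.lipschitz i _ hmem _ hv _ (hY t i ω) _ (hY t i ω))).2
    simp only [add_sub_cancel_left, map_smul, smul_eq_mul, sub_self, norm_zero, add_zero, hnorm]
      at h1 h2
    have h3 : s * p.g t i ω w ≤ s * (L * ‖w‖) := by linarith
    exact le_of_mul_le_mul_left h3 hs0
  refine ContinuousLinearMap.opNorm_le_bound _ hL fun w => ?_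
  rw [Real.norm_eq_abs, abs_le']
  refine ⟨key w, ?_⟩
  have := key (-w)
  rwa [map_neg, norm_neg] at this

theorem IsUnbiased.sq_gHat [MeasurableSpace E] [IsProbabilityMeasure P]
    (hu : IsUnbiased N p q P ξ ν ℱ) (hr : IsRun N p q P ξ α ℱ)
    (ha : N.IsAdmissible Y P ξ η B L) (hη : 0 < η) (hL : 0 ≤ L)
    (hY : ∀ t i ω, N.u q t i ω ∈ Y) (hℱ : ∀ t, ℱ t ≤ ‹_›) (t : ℕ) (i : Fin n) :
    Integrable (fun ω => ‖p.gHat t i ω‖ ^ 2) P ∧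
      ∫ ω, ‖p.gHat t i ω‖ ^ 2 ∂P ≤ 2 * L ^ 2 + 2 * ν ^ 2 := by
  have hint : Integrable (fun ω => 2 * L ^ 2 + 2 * ‖p.g t i ω - p.gHat t i ω‖ ^ 2) P :=
    (integrable_const _).add ((hu.sq_int t i).const_mul 2)
  have hle : ∀ᵐ ω ∂P, ‖p.gHat t i ω‖ ^ 2 ≤ 2 * L ^ 2 + 2 * ‖p.g t i ω - p.gHat t i ω‖ ^ 2 := by
    filter_upwards [hu.ae_norm_g_le hr ha hη hL hY t i] with ω hω
    have h1 : ‖p.gHat t i ω‖ ≤ L + ‖p.g t i ω - p.gHat t i ω‖ := by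
      have := norm_sub_le (p.g t i ω) (p.g t i ω - p.gHat t i ω)
      rw [sub_sub_cancel] at this
      linarith
    nlinarith [norm_nonneg (p.gHat t i ω), sq_nonneg (L - ‖p.g t i ω - p.gHat t i ω‖)]
  have hi : Integrable (fun ω => ‖p.gHat t i ω‖ ^ 2) P := by
    refine hint.mono' ((hu.gHat_int t i).aestronglyMeasurable.norm.pow 2) ?_
    filter_upwards [hle] with ω hω
    rwa [Real.norm_of_nonneg (by positivity)]
  refine ⟨hi, (integral_mono_ae hi hint hle).trans ?_⟩
  rw [integral_add (integrable_const _) ((hu.sq_int t i).const_mul 2)]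
  have hν : ∫ ω, ‖p.g t i ω - p.gHat t i ω‖ ^ 2 ∂P ≤ ν ^ 2 := by
    rw [← integral_condExp (hℱ t)]
    refine (integral_mono_ae integrable_condExp (integrable_const _) (hu.variance t i)).trans ?_
    simp
  simp only [integral_const, integral_const_mul, probReal_univ, one_smul]
  linarith

theorem IsUnbiased.integral_norm_gHat_le [MeasurableSpace E] [IsProbabilityMeasure P]
    (hu : IsUnbiased N p q P ξ ν ℱ) (hr : IsRun N p q P ξ α ℱ)
    (ha : N.IsAdmissible Y P ξ η B L) (hη : 0 < η) (hL : 0 ≤ L)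
    (hY : ∀ t i ω, N.u q t i ω ∈ Y) (hℱ : ∀ t, ℱ t ≤ ‹_›) (t : ℕ) (i : Fin n) :
    ∫ ω, ‖p.gHat t i ω‖ ∂P ≤ 1 + L ^ 2 + ν ^ 2 := by
  obtain ⟨hi, hle⟩ := hu.sq_gHat hr ha hη hL hY hℱ t i
  -- The bound a ≤ 1 + a²/2 reduces the first moment to the second.
  have h := integral_mono (μ := P) (hu.gHat_int t i).norm
    ((integrable_const (1 : ℝ)).add (hi.const_mul (1 / 2)))
    fun ω => (by
      simp only [Pi.add_apply]
      nlinarith [sq_nonneg (‖p.gHat t i ω‖ - 1)] :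
      ‖p.gHat t i ω‖ ≤ _)
  rw [integral_add' (integrable_const _) (hi.const_mul _), integral_const_mul] at h
  simp only [integral_const, probReal_univ, one_smul] at h
  linarith

/-- Conditioning on `ℱ t` pulls the known vector `w` out of the pairing; boundedness of `w` supplies
integrability. -/
theorem IsUnbiased.integral_gHat_apply [FiniteDimensional ℝ E] [MeasurableSpace E] [BorelSpace E]
    [IsProbabilityMeasure P] (hu : IsUnbiased N p q P ξ ν ℱ) (hℱ : ∀ t, ℱ t ≤ ‹_›)
    {t : ℕ} {w : Ω → E} {C : ℝ} (hw : Measurable[ℱ t] w) (hwC : ∀ ω, ‖w ω‖ ≤ C) (i : Fin n) :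
    Integrable (fun ω => p.gHat t i ω (w ω)) P ∧ Integrable (fun ω => p.g t i ω (w ω)) P ∧
      ∫ ω, p.gHat t i ω (w ω) ∂P = ∫ ω, p.g t i ω (w ω) ∂P := by
  have hws : StronglyMeasurable[ℱ t] w := hw.stronglyMeasurable
  have hint : ∀ h : Ω → E →L[ℝ] ℝ, Integrable h P → Integrable (fun ω => h ω (w ω)) P := by
    intro h hh
    refine (hh.norm.mul_const C).mono' (isBoundedBilinearMap_apply.continuous.comp_aestronglyMeasurable
      (hh.aestronglyMeasurable.prodMk (hws.mono (hℱ t)).aestronglyMeasurable)) ?_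
    refine Eventually.of_forall fun ω => ((h ω).le_opNorm _).trans ?_
    exact mul_le_mul_of_nonneg_left (hwC ω) (norm_nonneg _)
  have hg : Integrable (p.g t i) P := integrable_condExp.congr (hu.unbiased t i)
  refine ⟨hint _ (hu.gHat_int t i), hint _ hg, ?_⟩
  have h := condExp_bilin_of_stronglyMeasurable_right (m := ℱ t) (μ := P)
    (ContinuousLinearMap.id ℝ (E →L[ℝ] ℝ)) (f := p.gHat t i) (g := w) hws
    (hint _ (hu.gHat_int t i)) (hu.gHat_int t i)
  rw [← integral_condExp (hℱ t)]
  refine integral_congr_ae (h.trans ?_)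
  filter_upwards [hu.unbiased t i] with ω hω
  simp [hω]

theorem IsRun.integrable_disagreement [FiniteDimensional ℝ E] [MeasurableSpace E]
    [BorelSpace E] [IsProbabilityMeasure P] (hr : IsRun N p q P ξ α ℱ)
    (ha : N.IsAdmissible Y P ξ η B L) (hx : ∀ t i, Measurable (p.x t i)) (t : ℕ) :
    Integrable (fun ω => disagreement (fun i => p.x t i ω)) P := by
  refine integrable_comp_of_continuousOn (isCompact_univ_pi fun _ : Fin n => ha.X_compact)
    (f := disagreement) ?_ (measurable_pi_lambda _ fun i => hx t i)
    (fun ω i _ => hr.x_mem t i ω)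
  unfold disagreement
  fun_prop

/-- Bound on the accumulated expected disagreement inside one network. -/
theorem IsRun.sum_integral_disagreement_le [FiniteDimensional ℝ E] [MeasurableSpace E]
    [BorelSpace E] [IsProbabilityMeasure P] (hr : IsRun N p q P ξ α ℱ)
    (hu : IsUnbiased N p q P ξ ν ℱ)
    (ha : N.IsAdmissible Y P ξ η B L) (hη : 0 < η) (hL : 0 ≤ L)
    (hY : ∀ t i ω, N.u q t i ω ∈ Y) (hℱ : ∀ t, ℱ t ≤ ‹_›)
    (hx : ∀ t i, Measurable (p.x t i)) (hinit : ∀ i ω, ‖p.x 0 i ω‖ ≤ Λ) (hn : 0 < n)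
    (hα : Antitone α) (hα0 : ∀ t, 0 ≤ α t) (T : ℕ) :
    η ^ (n * B) * ∑ t ∈ Finset.range T, ∫ ω, disagreement (fun i => p.x t i ω) ∂P ≤
      (n * B : ℕ) * (2 * Λ + 2 * ((n * B : ℕ) * (n * (1 + L ^ 2 + ν ^ 2) * α 0))) +
      2 * ((n * B : ℕ) * (n * (1 + L ^ 2 + ν ^ 2) * ∑ t ∈ Finset.range T, α t)) := by
  set K : ℝ := n * (1 + L ^ 2 + ν ^ 2) with hK
  have hK0 : 0 ≤ K := by positivity
  -- Summing over agents gives one perturbation bound valid for all of them, at the price of the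
  -- factor n in `K`.
  set e : Ω → ℕ → ℝ := fun ω t => ∑ i, α t * ‖p.gHat t i ω‖ with he
  have hstep : ∀ ω t i, ‖p.x (t + 1) i ω - ∑ j, N.W t i j • p.x t j ω‖ ≤ e ω t := fun ω t i => by
    have h1 := (hr.update t i ω).norm_sub_le ha.regularizer (hr.v_mem ha hη t i ω)
    rw [norm_neg, norm_smul, Real.norm_of_nonneg (hα0 t)] at h1
    exact h1.trans (Finset.single_le_sum (f := fun i => α t * ‖p.gHat t i ω‖)
      (fun j _ => mul_nonneg (hα0 t) (norm_nonneg _)) (Finset.mem_univ i))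
  have heint : ∀ t, Integrable (fun ω => e ω t) P := fun t =>
    integrable_finsetSum _ fun i _ => (hu.gHat_int t i).norm.const_mul _
  have hele : ∀ t, ∫ ω, e ω t ∂P ≤ K * α t := fun t => by
    simp only [he]
    rw [integral_finsetSum _ fun i _ => (hu.gHat_int t i).norm.const_mul _]
    calc ∑ i, ∫ ω, α t * ‖p.gHat t i ω‖ ∂P ≤ ∑ _i : Fin n, α t * (1 + L ^ 2 + ν ^ 2) := by
          refine Finset.sum_le_sum fun i _ => ?_
          rw [integral_const_mul]
          exact mul_le_mul_of_nonneg_left (hu.integral_norm_gHat_le hr ha hη hL hY hℱ t i) (hα0 t)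
      _ = K * α t := by simp [hK]; ring
  have hVint := hr.integrable_disagreement ha hx
  -- Used twice: with δ = η^(nB) over n windows for the contraction, and with δ = 0 from time 0 for
  -- the crude growth bound.
  have hexp : ∀ s k (δ : ℝ), 0 ≤ δ → (∀ i j, δ ≤ transition N.W s k i j) →
      ∫ ω, disagreement (fun i => p.x (s + k) i ω) ∂P ≤
        (1 - δ) * ∫ ω, disagreement (fun i => p.x s i ω) ∂P + 2 * (k * (K * α s)) := by
    intro s k δ hδ hT
    have h1 : ∀ ω, disagreement (fun i => p.x (s + k) i ω) ≤
        (1 - δ) * disagreement (fun i => p.x s i ω) + 2 * ∑ l ∈ Finset.range k, e ω (s + l) :=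
      fun ω => ha.mixing.disagreement_add_le hη (x := fun t i => p.x t i ω) (hstep ω) hδ s k hT hn
    have hsum : Integrable (fun ω => ∑ l ∈ Finset.range k, e ω (s + l)) P :=
      integrable_finsetSum _ fun l _ => heint (s + l)
    have h2 := integral_mono (hVint (s + k)) (((hVint s).const_mul (1 - δ)).add (hsum.const_mul 2)) h1
    rw [integral_add' ((hVint s).const_mul (1 - δ)) (hsum.const_mul 2), integral_const_mul,
      integral_const_mul, integral_finsetSum _ fun l _ => heint (s + l)] at h2
    have h3 : ∑ l ∈ Finset.range k, ∫ ω, e ω (s + l) ∂P ≤ k * (K * α s) := by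
      have : ∀ l ∈ Finset.range k, ∫ ω, e ω (s + l) ∂P ≤ K * α s := fun l _ =>
        (hele _).trans (mul_le_mul_of_nonneg_left (hα (Nat.le_add_right _ _)) hK0)
      simpa using Finset.sum_le_card_nsmul _ _ _ this
    linarith
  have hd0 : ∫ ω, disagreement (fun i => p.x 0 i ω) ∂P ≤ 2 * Λ := by
    have h1 : ∀ ω, disagreement (fun i => p.x 0 i ω) ≤ 2 * Λ := fun ω => by
      have hij : ∀ i j, ‖p.x 0 i ω - p.x 0 j ω‖ ≤ 2 * Λ := fun i j => by
        linarith [norm_sub_le (p.x 0 i ω) (p.x 0 j ω), hinit i ω, hinit j ω]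
      exact disagreement_le ((norm_nonneg _).trans (hij ⟨0, hn⟩ ⟨0, hn⟩)) hij
    simpa using integral_mono (hVint 0) (integrable_const (2 * Λ)) h1
  have hmain := mul_sum_le_of_window_contraction (α := α)
    (d := fun t => ∫ ω, disagreement (fun i => p.x t i ω) ∂P) (δ := η ^ (n * B)) (K := K)
    (M := n * B) (fun t => integral_nonneg fun ω => disagreement_nonneg _)
    (fun k => by
      have := hexp 0 k 0 le_rfl (ha.mixing.transition_nonneg hη 0 k)
      simpa using this)
    (fun s => hexp s (n * B) _ (by positivity) (ha.mixing.pow_le_transition hη s))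
    (mul_nonneg hK0 (hα0 0)) T
  refine hmain.trans ?_
  gcongr

end Run

/-- Summation by parts with antitone positive step sizes. -/
theorem sum_sub_div_le {Δ α : ℕ → ℝ} {c : ℝ} (hΔ : ∀ t, Δ t ≤ c) (hΔ0 : ∀ t, 0 ≤ Δ t)
    (hα : Antitone α) (hpos : ∀ t, 0 < α t) {T : ℕ} (hT : 1 ≤ T) :
    ∑ t ∈ Finset.Icc 1 T, (Δ t - Δ (t + 1)) / α t ≤ c / α T := by
  -- Keeping -Δ(T+1) in the bound is what lets the induction close.
  have h : ∑ t ∈ Finset.Icc 1 T, (Δ t - Δ (t + 1)) / α t ≤ (c - Δ (T + 1)) / α T := by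
    induction T, hT using Nat.le_induction with
    | base =>
      simp only [Finset.Icc_self, Finset.sum_singleton]
      exact div_le_div_of_nonneg_right (by linarith [hΔ 1]) (hpos 1).le
    | succ T hT ih =>
      rw [Finset.sum_Icc_succ_top (by omega)]
      have h1 : (c - Δ (T + 1)) / α T ≤ (c - Δ (T + 1)) / α (T + 1) :=
        div_le_div_of_nonneg_left (sub_nonneg.2 (hΔ _)) (hpos _) (hα (Nat.le_succ T))
      calc _ ≤ (c - Δ (T + 1)) / α (T + 1) + (Δ (T + 1) - Δ (T + 1 + 1)) / α (T + 1) := by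
            linarith
        _ = _ := by rw [← add_div]; ring_nf
  exact h.trans (div_le_div_of_nonneg_right (by linarith [hΔ0 (T + 1)]) (hpos T).le)

/-- Telescoping of 1/√(t+1) ≤ 2(√(t+1) - √t); the arbitrary α(0) stands apart. -/
theorem sum_range_one_div_sqrt_le {α : ℕ → ℝ} (hα : ∀ t : ℕ, 1 ≤ t → α t ≤ 1 / √(t : ℝ)) (T : ℕ) :
    ∑ t ∈ Finset.range (T + 1), α t ≤ α 0 + 2 * √(T : ℝ) := by
  induction T with
  | zero => simp
  | succ T ih =>
    rw [Finset.sum_range_succ]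
    have h1 := hα (T + 1) (by omega)
    have h2 : 1 / √((T + 1 : ℕ) : ℝ) ≤ 2 * (√((T + 1 : ℕ) : ℝ) - √(T : ℝ)) := by
      have hp : 0 < √((T + 1 : ℕ) : ℝ) := Real.sqrt_pos.2 (by positivity)
      have hs1 : √((T + 1 : ℕ) : ℝ) ^ 2 = T + 1 := by
        rw [Real.sq_sqrt (by positivity)]; push_cast; ring
      have hs2 : √(T : ℝ) ^ 2 = T := Real.sq_sqrt (by positivity)
      rw [div_le_iff₀ hp]
      nlinarith [sq_nonneg (√((T + 1 : ℕ) : ℝ) - √(T : ℝ))]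
    linarith

/-! ### From linearized regret to costs -/

section Costs

variable {Ω : Type w} [MeasurableSpace Ω]
  {E : Type u} [NormedAddCommGroup E] [NormedSpace ℝ E]
  {F : Type v} [NormedAddCommGroup F] [NormedSpace ℝ F] {n m d : ℕ}
  {N : Network E F n m d} {p : Iterates Ω E n d} {q : Iterates Ω F m d} {P : Measure Ω}
  {ξ : Ω → (Fin d → ℝ)} {α : ℕ → ℝ} {ℱ : ℕ → MeasurableSpace Ω} {Y : Set F} {η L R : ℝ} {B : ℕ}

theorem Network.IsAdmissible.continuousOn_avgCost (ha : N.IsAdmissible Y P ξ η B L) (hL : 0 ≤ L) :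
    ContinuousOn (fun z : E × F => N.avgCost P ξ z.1 z.2) (N.X ×ˢ Y) := by
  unfold Network.avgCost
  refine ContinuousOn.mul continuousOn_const (continuousOn_finsetSum _ fun i _ => ?_)
  refine (LipschitzOnWith.of_dist_le_mul (K := (2 * L).toNNReal)
    fun z hz z' hz' => ?_).continuousOn
  rw [Real.dist_eq]
  refine (ha.lipschitz i _ (ha.X_subset hz.1) _ (ha.X_subset hz'.1) _ hz.2 _ hz'.2).trans ?_
  have h1 : ‖z.1 - z'.1‖ ≤ dist z z' := by
    rw [dist_eq_norm]; exact norm_fst_le (z - z')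
  have h2 : ‖z.2 - z'.2‖ ≤ dist z z' := by
    rw [dist_eq_norm]; exact norm_snd_le (z - z')
  have := mul_le_mul_of_nonneg_left (add_le_add h1 h2) hL
  rw [Real.coe_toNNReal _ (by positivity)]
  linarith

/-- Regret of the linearized sampled costs along a run. -/
theorem IsRun.sum_gHat_apply_le [MeasurableSpace E] (hr : IsRun N p q P ξ α ℱ)
    (ha : N.IsAdmissible Y P ξ η B L) (hη : 0 < η)
    (hdiam : ∀ x ∈ N.X, ∀ x' ∈ N.X, bregman N.X N.reg x x' ≤ R)
    (hα : Antitone α) (hpos : ∀ t, 0 < α t) {z : E} (hz : z ∈ N.X) {T : ℕ} (hT : 1 ≤ T) (ω : Ω) :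
    ∑ t ∈ Finset.Icc 1 T, ∑ j, p.gHat t j ω (N.v p t j ω - z) ≤
      n * R / α T + ∑ t ∈ Finset.Icc 1 T, α t * (1 / 2 * ∑ j, ‖p.gHat t j ω‖ ^ 2) := by
  set Δ : ℕ → ℝ := fun t => ∑ j, bregman N.X N.reg z (p.x t j ω) with hΔ
  have hΔ0 : ∀ t, 0 ≤ Δ t := fun t =>
    Finset.sum_nonneg fun j _ => bregman_nonneg ha.regularizer (hr.x_mem t j ω) hz
  have hΔR : ∀ t, Δ t ≤ n * R := fun t => by
    have : ∀ j ∈ Finset.univ, bregman N.X N.reg z (p.x t j ω) ≤ R := fun j _ =>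
      hdiam _ hz _ (hr.x_mem t j ω)
    simpa using Finset.sum_le_card_nsmul _ _ _ this
  have hstep : ∀ t, ∑ j, p.gHat t j ω (N.v p t j ω - z) ≤
      (Δ t - Δ (t + 1)) / α t + α t * (1 / 2 * ∑ j, ‖p.gHat t j ω‖ ^ 2) := by
    intro t
    have h1 : ∀ j, α t * p.gHat t j ω (N.v p t j ω - z) ≤
        bregman N.X N.reg z (N.v p t j ω) - bregman N.X N.reg z (p.x (t + 1) j ω) +
          α t ^ 2 * (1 / 2 * ‖p.gHat t j ω‖ ^ 2) := fun j => by
      have h := (hr.update t j ω).linear_regret_le ha.regularizer (hr.v_mem ha hη t j ω) hz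
      rw [norm_smul, Real.norm_of_nonneg (hpos t).le, mul_pow] at h
      simp only [smul_apply, smul_eq_mul] at h
      linarith
    -- Row sums make v_j a convex combination, column sums restore each agent's divergence exactly
    -- once.
    have h2 : ∑ j, bregman N.X N.reg z (N.v p t j ω) ≤ Δ t := by
      calc _ ≤ ∑ j, ∑ k, N.W t j k * bregman N.X N.reg z (p.x t k ω) := by
            refine Finset.sum_le_sum fun j _ => ?_
            exact (ha.regularizer.convex_right z hz).map_sum_le
              (fun k _ => ha.mixing.weight_nonneg hη t j k) (ha.mixing.row_sum t j)
              fun k _ => hr.x_mem t k ω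
        _ = Δ t := by
            rw [Finset.sum_comm]
            simp_rw [← Finset.sum_mul, ha.mixing.col_sum, one_mul, hΔ]
    have h3 : α t * ∑ j, p.gHat t j ω (N.v p t j ω - z) ≤
        Δ t - Δ (t + 1) + α t ^ 2 * (1 / 2 * ∑ j, ‖p.gHat t j ω‖ ^ 2) := by
      have := Finset.sum_le_sum fun j (_ : j ∈ Finset.univ) => h1 j
      simp only [Finset.sum_add_distrib, Finset.sum_sub_distrib, ← Finset.mul_sum] at this
      linarith
    have hp := hpos t
    calc _ = (α t * ∑ j, p.gHat t j ω (N.v p t j ω - z)) / α t := by field_simp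
      _ ≤ (Δ t - Δ (t + 1) + α t ^ 2 * (1 / 2 * ∑ j, ‖p.gHat t j ω‖ ^ 2)) / α t :=
          div_le_div_of_nonneg_right h3 hp.le
      _ = _ := by field_simp
  refine (Finset.sum_le_sum fun t _ => hstep t).trans ?_
  rw [Finset.sum_add_distrib]
  exact add_le_add (sum_sub_div_le hΔR hΔ0 hα hpos hT) le_rfl

/-- Instantaneous regret of agent `i` in terms of the subgradients of all agents and the
disagreements in both networks. -/
theorem IsRun.mul_avgCost_sub_le [MeasurableSpace E] (hr : IsRun N p q P ξ α ℱ)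
    (ha : N.IsAdmissible Y P ξ η B L) (hη : 0 < η) (hL : 0 ≤ L) (hY : ∀ t i ω, N.u q t i ω ∈ Y)
    {z : E} (hz : z ∈ N.X) {t : ℕ} (i : Fin n) {ω : Ω}
    (hg : ∀ j, IsSubgradient N.O
      (fun x => N.cost P ξ j x (N.u q t j ω)) (N.v p t j ω) (p.g t j ω)) :
    n * (N.avgCost P ξ (p.x t i ω) (N.u q t i ω) - N.avgCost P ξ z (N.u q t i ω)) ≤
      ∑ j, p.g t j ω (N.v p t j ω - z) + n * (L * (disagreement (fun j => p.x t j ω) +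
        2 * disagreement (fun j => q.x t j ω))) := by
  have hn : (n : ℝ) ≠ 0 := by
    have := i.pos
    positivity
  -- Go from (x_i, u_i) to (v_j, u_j), apply the subgradient inequality towards z, then return from
  -- (z, u_j) to (z, u_i). The opponent's argument moves twice, whence the factor 2.
  have h1 : ∀ j, N.cost P ξ j (p.x t i ω) (N.u q t i ω) - N.cost P ξ j z (N.u q t i ω) ≤
      p.g t j ω (N.v p t j ω - z) + L * (disagreement (fun j => p.x t j ω) +
        2 * disagreement (fun j => q.x t j ω)) := fun j => by
    have hzO := ha.X_subset hz
    have hxO := ha.X_subset (hr.x_mem t i ω)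
    have hvO := ha.X_subset (hr.v_mem ha hη t j ω)
    have hs := hg j z hzO
    have hl1 := (abs_le.1 (ha.lipschitz j _ hxO _ hvO _ (hY t i ω) _ (hY t j ω))).2
    have hl2 := (abs_le.1 (ha.lipschitz j _ hzO _ hzO _ (hY t j ω) _ (hY t i ω))).2
    have hV : ‖p.x t i ω - N.v p t j ω‖ ≤ disagreement (fun j => p.x t j ω) := by
      have := norm_weighted_sub_le (fun j => p.x t j ω) (a := Pi.single i 1) (b := N.W t j) (r := 1)
        (fun k => by by_cases hk : k = i <;> simp [hk])
        (ha.mixing.weight_nonneg hη t j) (by simp) (ha.mixing.row_sum t j)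
      simpa [Pi.single_apply, Network.v] using this
    have hU : ∀ a b, ‖N.u q t a ω - N.u q t b ω‖ ≤ disagreement (fun j => q.x t j ω) :=
      fun a b => by
        simpa [Network.u] using norm_weighted_sub_le (fun j => q.x t j ω) (ha.cross.nonneg t a)
          (ha.cross.nonneg t b) (ha.cross.row_sum t a) (ha.cross.row_sum t b)
    have hV' := mul_le_mul_of_nonneg_left (add_le_add hV (hU i j)) hL
    have hU' := mul_le_mul_of_nonneg_left (hU j i) hL
    have hneg : p.g t j ω (z - N.v p t j ω) = -(p.g t j ω (N.v p t j ω - z)) := by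
      rw [← map_neg, neg_sub]
    simp only [sub_self, norm_zero, zero_add] at hl2
    rw [hneg] at hs
    linarith
  have h2 := Finset.sum_le_sum fun j (_ : j ∈ Finset.univ) => h1 j
  rw [Finset.sum_sub_distrib, Finset.sum_add_distrib, Finset.sum_const, Finset.card_univ,
    Fintype.card_fin, nsmul_eq_mul] at h2
  unfold Network.avgCost
  rw [← mul_sub, ← mul_assoc, mul_one_div_cancel hn, one_mul]
  exact h2

end Costs

/-! ### The information filtration -/

section Information

variable {Ω : Type w} {E₁ : Type u} [NormedAddCommGroup E₁] [NormedSpace ℝ E₁] [MeasurableSpace E₁]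
  {E₂ : Type v} [NormedAddCommGroup E₂] [NormedSpace ℝ E₂] [MeasurableSpace E₂] {n₁ n₂ d : ℕ}

theorem info_mono (p₁ : Iterates Ω E₁ n₁ d) (p₂ : Iterates Ω E₂ n₂ d) : Monotone (info p₁ p₂) := by
  intro s t hst
  refine sup_le_sup (sup_le_sup le_rfl (iSup_le fun r => ?_)) (iSup_le fun r => ?_)
  · exact le_iSup (fun r : Fin t => ⨆ i, MeasurableSpace.comap (p₁.ξ r i) inferInstance)
      (Fin.castLE hst r)
  · exact le_iSup (fun r : Fin t => ⨆ j, MeasurableSpace.comap (p₂.ξ r j) inferInstance)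
      (Fin.castLE hst r)

theorem measurable_info_left (p₁ : Iterates Ω E₁ n₁ d) (p₂ : Iterates Ω E₂ n₂ d) (i : Fin n₁) :
    Measurable[info p₁ p₂ 0] (p₁.x 0 i) :=
  Measurable.of_comap_le <|
    (le_iSup (fun i => MeasurableSpace.comap (p₁.x 0 i) inferInstance) i).trans
      (le_sup_left.trans (le_sup_left.trans le_sup_left))

theorem measurable_info_right (p₁ : Iterates Ω E₁ n₁ d) (p₂ : Iterates Ω E₂ n₂ d) (j : Fin n₂) :
    Measurable[info p₁ p₂ 0] (p₂.x 0 j) :=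
  Measurable.of_comap_le <|
    (le_iSup (fun j => MeasurableSpace.comap (p₂.x 0 j) inferInstance) j).trans
      (le_sup_right.trans (le_sup_left.trans le_sup_left))

theorem IsRun.info_le [MeasurableSpace Ω] {N₁ : Network E₁ E₂ n₁ n₂ d} {N₂ : Network E₂ E₁ n₂ n₁ d}
    {p₁ : Iterates Ω E₁ n₁ d} {p₂ : Iterates Ω E₂ n₂ d} {P : Measure Ω} {ξ : Ω → (Fin d → ℝ)}
    {α : ℕ → ℝ} {q₁ : Iterates Ω E₁ n₁ d} {q₂ : Iterates Ω E₂ n₂ d}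
    {ℱ 𝒢 : ℕ → MeasurableSpace Ω}
    (h₁ : IsRun N₁ p₁ q₂ P ξ α ℱ) (h₂ : IsRun N₂ p₂ q₁ P ξ α 𝒢) (t : ℕ) :
    info p₁ p₂ t ≤ ‹MeasurableSpace Ω› := by
  refine sup_le (sup_le (sup_le ?_ ?_) ?_) ?_
  · exact iSup_le fun i => (h₁.init_meas i).comap_le
  · exact iSup_le fun j => (h₂.init_meas j).comap_le
  · exact iSup_le fun s => iSup_le fun i => (h₁.sample_meas s i).comap_le
  · exact iSup_le fun s => iSup_le fun j => (h₂.sample_meas s j).comap_le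

end Information

/-! ### Expected regret in the game -/

section Game

variable {Ω : Type w} [MeasurableSpace Ω]
  {E₁ : Type u} [NormedAddCommGroup E₁] [NormedSpace ℝ E₁] [FiniteDimensional ℝ E₁]
  [MeasurableSpace E₁] [BorelSpace E₁]
  {E₂ : Type v} [NormedAddCommGroup E₂] [NormedSpace ℝ E₂] [FiniteDimensional ℝ E₂]
  [MeasurableSpace E₂] [BorelSpace E₂] {n₁ n₂ d : ℕ}
  {N₁ : Network E₁ E₂ n₁ n₂ d} {N₂ : Network E₂ E₁ n₂ n₁ d}
  {p₁ : Iterates Ω E₁ n₁ d} {p₂ : Iterates Ω E₂ n₂ d} {P : Measure Ω} {ξ : Ω → (Fin d → ℝ)}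
  {B₁ B₂ : ℕ} {η L ν₁ ν₂ Λ₁ Λ₂ R : ℝ} {α : ℕ → ℝ}

variable [IsProbabilityMeasure P]

theorem IsGameRun.integrable_avgCost (h : IsGameRun N₁ N₂ p₁ p₂ P ξ B₁ B₂ η L ν₁ ν₂ Λ₁ Λ₂ R α)
    (hη : 0 < η) (hL : 0 ≤ L) {w : Ω → E₁} (hw : Measurable w) (hwX : ∀ ω, w ω ∈ N₁.X)
    (t : ℕ) (i : Fin n₁) :
    Integrable (fun ω => N₁.avgCost P ξ (w ω) (N₁.u p₂ t i ω)) P := by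
  have hu : Measurable (N₁.u p₂ t i) := by
    refine Finset.measurable_fun_sum _ fun j _ => ?_
    exact ((h.run₂.measurable_x h.adm₂ hη (info_mono p₁ p₂) (measurable_info_right p₁ p₂) t j).mono
      (h.run₁.info_le h.run₂ t) le_rfl).const_smul _
  exact integrable_comp_of_continuousOn (h.adm₁.X_compact.prod h.adm₂.X_compact)
    (h.adm₁.continuousOn_avgCost hL) (v := fun ω => (w ω, N₁.u p₂ t i ω)) (hw.prodMk hu)
    fun ω => ⟨hwX ω, h.adm₁.u_mem h.adm₂.X_convex h.run₂.x_mem t i ω⟩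

theorem IsGameRun.regretExists (h : IsGameRun N₁ N₂ p₁ p₂ P ξ B₁ B₂ η L ν₁ ν₂ Λ₁ Λ₂ R α)
    (hη : 0 < η) (hL : 0 ≤ L) (i : Fin n₁) (T : ℕ) : RegretExists N₁ p₁ p₂ P ξ i T := by
  have hfix : ∀ x₁ ∈ N₁.X, Integrable (fixedCost N₁ p₂ P ξ i T x₁) P := fun x₁ hx₁ =>
    integrable_finsetSum _ fun t _ =>
      h.integrable_avgCost hη hL (w := fun _ => x₁) measurable_const (fun _ => hx₁) t i
  refine ⟨integrable_finsetSum _ fun t _ => h.integrable_avgCost hη hL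
    ((h.run₁.measurable_x h.adm₁ hη (info_mono p₁ p₂) (measurable_info_left p₁ p₂) t i).mono
      (h.run₁.info_le h.run₂ t) le_rfl) (h.run₁.x_mem t i) t i, hfix, ?_⟩
  obtain ⟨ω⟩ : Nonempty Ω := P.nonempty_of_neZero
  refine h.adm₁.X_compact.exists_isMinOn ⟨_, h.run₁.x_mem 0 i ω⟩ ?_
  obtain ⟨C, hC⟩ := (h.adm₁.X_compact.prod h.adm₂.X_compact).exists_bound_of_continuousOn
    (h.adm₁.continuousOn_avgCost hL)
  have hu := h.adm₁.u_mem h.adm₂.X_convex h.run₂.x_mem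
  have hcost : ∀ t ω, ContinuousOn (fun x => N₁.avgCost P ξ x (N₁.u p₂ t i ω)) N₁.X := fun t ω =>
    (h.adm₁.continuousOn_avgCost hL).comp (f := fun x : E₁ => (x, N₁.u p₂ t i ω)) (s := N₁.X)
      (by fun_prop) fun x hx => ⟨hx, hu t i ω⟩
  -- The average cost is bounded on the compact product, so dominated convergence makes the expected
  -- cost continuous in the fixed strategy.
  refine continuousOn_of_dominated (bound := fun _ => ∑ _t ∈ Finset.Icc 1 T, C)
    (fun x hx => (hfix x hx).aestronglyMeasurable)
    (fun x hx => Eventually.of_forall fun ω => norm_sum_le_of_le _ fun t _ =>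
      hC (x, N₁.u p₂ t i ω) ⟨hx, hu t i ω⟩)
    (integrable_const _) (Eventually.of_forall fun ω => continuousOn_finsetSum _ fun t _ => hcost t ω)

/-- Regret against a fixed strategy in terms of the step sizes and the disagreements. -/
theorem IsGameRun.integral_played_sub_fixed_le
    (h : IsGameRun N₁ N₂ p₁ p₂ P ξ B₁ B₂ η L ν₁ ν₂ Λ₁ Λ₂ R α) (hη : 0 < η) (hL : 0 ≤ L)
    (hα : Antitone α) (hpos : ∀ t, 0 < α t) (i : Fin n₁) {T : ℕ} (hT : 1 ≤ T)
    {z : E₁} (hz : z ∈ N₁.X) :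
    (∫ ω, playedCost N₁ p₁ p₂ P ξ i T ω ∂P) - ∫ ω, fixedCost N₁ p₂ P ξ i T z ω ∂P ≤
      R / α T + (L ^ 2 + ν₁ ^ 2) * ∑ t ∈ Finset.Icc 1 T, α t +
      L * (∑ t ∈ Finset.Icc 1 T, ∫ ω, disagreement (fun j => p₁.x t j ω) ∂P +
        2 * ∑ t ∈ Finset.Icc 1 T, ∫ ω, disagreement (fun j => p₂.x t j ω) ∂P) := by
  have hn : (0 : ℝ) < n₁ := by exact_mod_cast i.pos
  have hℱ := h.run₁.info_le h.run₂
  have hY := h.adm₁.u_mem h.adm₂.X_convex h.run₂.x_mem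
  have hx₁ := h.run₁.measurable_x h.adm₁ hη (info_mono p₁ p₂) (measurable_info_left p₁ p₂)
  have hx₂ := h.run₂.measurable_x h.adm₂ hη (info_mono p₁ p₂) (measurable_info_right p₁ p₂)
  have hV₁ : ∀ t, Integrable (fun ω => disagreement (fun j => p₁.x t j ω)) P := fun t =>
    h.run₁.integrable_disagreement h.adm₁ (fun t j => (hx₁ t j).mono (hℱ t) le_rfl) t
  have hV₂ : ∀ t, Integrable (fun ω => disagreement (fun j => p₂.x t j ω)) P := fun t =>
    h.run₂.integrable_disagreement h.adm₂ (fun t j => (hx₂ t j).mono (hℱ t) le_rfl) t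
  obtain ⟨C, hC⟩ := h.adm₁.X_compact.exists_bound_of_continuousOn (f := fun x : E₁ => x - z)
    (by fun_prop)
  have hgv : ∀ t j, Integrable (fun ω => p₁.gHat t j ω (N₁.v p₁ t j ω - z)) P ∧
      Integrable (fun ω => p₁.g t j ω (N₁.v p₁ t j ω - z)) P ∧
      ∫ ω, p₁.gHat t j ω (N₁.v p₁ t j ω - z) ∂P = ∫ ω, p₁.g t j ω (N₁.v p₁ t j ω - z) ∂P := by
    intro t j
    refine h.unbiased₁.integral_gHat_apply hℱ (C := C) ?_
      (fun ω => hC _ (h.run₁.v_mem h.adm₁ hη t j ω)) j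
    have hv : Measurable[info p₁ p₂ t] (N₁.v p₁ t j) :=
      Finset.measurable_fun_sum _ fun k _ => (hx₁ t k).const_smul (N₁.W t j k)
    exact hv.sub_const z
  have hUp : ∀ t, Integrable (fun ω => N₁.avgCost P ξ (p₁.x t i ω) (N₁.u p₂ t i ω)) P := fun t =>
    h.integrable_avgCost hη hL ((hx₁ t i).mono (hℱ t) le_rfl) (h.run₁.x_mem t i) t i
  have hUz : ∀ t, Integrable (fun ω => N₁.avgCost P ξ z (N₁.u p₂ t i ω)) P := fun t =>
    h.integrable_avgCost hη hL (w := fun _ => z) measurable_const (fun _ => hz) t i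
  -- The pointwise bound holds with the true subgradients; only after integration do the sampled
  -- ones replace them.
  have hstep : ∀ t, n₁ * ((∫ ω, N₁.avgCost P ξ (p₁.x t i ω) (N₁.u p₂ t i ω) ∂P) -
        ∫ ω, N₁.avgCost P ξ z (N₁.u p₂ t i ω) ∂P) ≤
      (∫ ω, ∑ j, p₁.gHat t j ω (N₁.v p₁ t j ω - z) ∂P) +
      n₁ * (L * (∫ ω, disagreement (fun j => p₁.x t j ω) ∂P +
        2 * ∫ ω, disagreement (fun j => p₂.x t j ω) ∂P)) := by
    intro t
    have hg : Integrable (fun ω => ∑ j, p₁.g t j ω (N₁.v p₁ t j ω - z)) P :=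
      integrable_finsetSum _ fun j _ => (hgv t j).2.1
    have hae : ∀ᵐ ω ∂P, n₁ * (N₁.avgCost P ξ (p₁.x t i ω) (N₁.u p₂ t i ω) -
        N₁.avgCost P ξ z (N₁.u p₂ t i ω)) ≤
        ∑ j, p₁.g t j ω (N₁.v p₁ t j ω - z) + n₁ * (L * (disagreement (fun j => p₁.x t j ω) +
          2 * disagreement (fun j => p₂.x t j ω))) := by
      filter_upwards [ae_all_iff.2 fun j => h.unbiased₁.g_sub t j] with ω hω
      exact h.run₁.mul_avgCost_sub_le h.adm₁ hη hL hY hz i hω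
    have hD := (((hV₁ t).add ((hV₂ t).const_mul 2)).const_mul L).const_mul (n₁ : ℝ)
    have hle := integral_mono_ae (((hUp t).sub (hUz t)).const_mul (n₁ : ℝ)) (hg.add hD) hae
    rw [integral_add' hg hD] at hle
    simp only [integral_const_mul] at hle
    rw [integral_sub' (hUp t) (hUz t), integral_add' (hV₁ t) ((hV₂ t).const_mul 2),
      integral_const_mul, integral_finsetSum _ fun j _ => (hgv t j).2.1] at hle
    rw [integral_finsetSum _ fun j _ => (hgv t j).1]
    simp_rw [(hgv t _).2.2]
    exact hle
  have hsq := h.unbiased₁.sq_gHat h.run₁ h.adm₁ hη hL hY hℱ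
  have hlin : ∑ t ∈ Finset.Icc 1 T, ∫ ω, ∑ j, p₁.gHat t j ω (N₁.v p₁ t j ω - z) ∂P ≤
      n₁ * (R / α T + (L ^ 2 + ν₁ ^ 2) * ∑ t ∈ Finset.Icc 1 T, α t) := by
    have hgs : ∀ t, Integrable (fun ω => ∑ j, p₁.gHat t j ω (N₁.v p₁ t j ω - z)) P := fun t =>
      integrable_finsetSum _ fun j _ => (hgv t j).1
    have hss : ∀ t, Integrable (fun ω => ∑ j, ‖p₁.gHat t j ω‖ ^ 2) P := fun t =>
      integrable_finsetSum _ fun j _ => (hsq t j).1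
    have hss' : ∀ t, Integrable (fun ω => α t * (1 / 2 * ∑ j, ‖p₁.gHat t j ω‖ ^ 2)) P := fun t =>
      ((hss t).const_mul _).const_mul _
    have hsum : Integrable
        (fun ω => ∑ t ∈ Finset.Icc 1 T, α t * (1 / 2 * ∑ j, ‖p₁.gHat t j ω‖ ^ 2)) P :=
      integrable_finsetSum _ fun t _ => hss' t
    have hle := integral_mono (integrable_finsetSum (Finset.Icc 1 T) fun t _ => hgs t)
      ((integrable_const (n₁ * R / α T)).add hsum)
      (h.run₁.sum_gHat_apply_le h.adm₁ hη h.diam hα hpos hz hT)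
    rw [integral_finsetSum _ fun t _ => hgs t, integral_add' (integrable_const _) hsum,
      integral_finsetSum _ fun t _ => hss' t, integral_const, probReal_univ, one_smul] at hle
    refine hle.trans ?_
    have hb : ∑ t ∈ Finset.Icc 1 T, ∫ ω, α t * (1 / 2 * ∑ j, ‖p₁.gHat t j ω‖ ^ 2) ∂P ≤
        ∑ t ∈ Finset.Icc 1 T, n₁ * ((L ^ 2 + ν₁ ^ 2) * α t) := by
      refine Finset.sum_le_sum fun t _ => ?_
      rw [integral_const_mul, integral_const_mul, integral_finsetSum _ fun j _ => (hsq t j).1]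
      have hj : ∑ j, ∫ ω, ‖p₁.gHat t j ω‖ ^ 2 ∂P ≤ n₁ * (2 * L ^ 2 + 2 * ν₁ ^ 2) := by
        have := Finset.sum_le_card_nsmul _ _ _ fun j (_ : j ∈ Finset.univ) => (hsq t j).2
        rwa [Finset.card_univ, Fintype.card_fin, nsmul_eq_mul] at this
      calc _ ≤ α t * (1 / 2 * (n₁ * (2 * L ^ 2 + 2 * ν₁ ^ 2))) :=
            mul_le_mul_of_nonneg_left (mul_le_mul_of_nonneg_left hj (by norm_num)) (hpos t).le
        _ = _ := by ring
    rw [← Finset.mul_sum, ← Finset.mul_sum] at hb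
    rw [mul_add, mul_div_assoc]
    exact add_le_add le_rfl hb
  unfold playedCost fixedCost
  rw [integral_finsetSum _ fun t _ => hUp t, integral_finsetSum _ fun t _ => hUz t,
    ← Finset.sum_sub_distrib]
  have hall := Finset.sum_le_sum fun t (_ : t ∈ Finset.Icc 1 T) => hstep t
  rw [Finset.sum_add_distrib, ← Finset.mul_sum, ← Finset.mul_sum, ← Finset.mul_sum,
    Finset.sum_add_distrib, ← Finset.mul_sum] at hall
  refine le_of_mul_le_mul_left ?_ hn
  rw [mul_add]
  linarith

end Game

/-! ### Choice of the step sizes -/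

/-- Bound on the accumulated disagreement of a network of `n` agents, per unit of the rate. -/
noncomputable def disagreementConstant (n B : ℕ) (η L ν Λ a : ℝ) : ℝ :=
  ((n * B : ℕ) * (2 * |Λ| + 2 * ((n * B : ℕ) * (n * (1 + L ^ 2 + ν ^ 2) * a))) +
    2 * ((n * B : ℕ) * (n * (1 + L ^ 2 + ν ^ 2) * (a + 2)))) / η ^ (n * B)

theorem regretOrder_rpow (n₁ n₂ B₁ B₂ : ℕ) {η L : ℝ} (ν₁ ν₂ Λ₁ Λ₂ R : ℝ) (hη : 0 < η) (hL : 0 ≤ L)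
    {ε : ℝ} (hε : 0 ≤ ε) {α : ℕ → ℝ} (hα : Antitone α)
    (hα' : ∀ t : ℕ, 1 ≤ t → α t = (t : ℝ) ^ (-(1 / 2 + ε))) :
    RegretOrder.{u, v, w} n₁ n₂ B₁ B₂ η L ν₁ ν₂ Λ₁ Λ₂ R α (fun T => (T : ℝ) ^ (1 / 2 + ε)) := by
  -- One summand for each of the divergence, second-moment and disagreement terms; absolute values
  -- appear because no sign of `R` or `Λ` is assumed.
  refine ⟨|R| + (L ^ 2 + ν₁ ^ 2) * (α 0 + 2) + L * (disagreementConstant n₁ B₁ η L ν₁ Λ₁ (α 0) +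
    2 * disagreementConstant n₂ B₂ η L ν₂ Λ₂ (α 0)), ?_⟩
  intro d E₁ _ _ _ _ _ E₂ _ _ _ _ _ Ω _ P _ ξ N₁ N₂ p₁ p₂ h i T hT
  have hex := h.regretExists hη hL i T
  refine ⟨hex, ?_⟩
  have hpos : ∀ t, 0 < α t := by
    have h1 : ∀ t : ℕ, 1 ≤ t → 0 < α t := fun t ht => by
      rw [hα' t ht]
      exact Real.rpow_pos_of_pos (by exact_mod_cast ht) _
    intro t
    rcases Nat.eq_zero_or_pos t with rfl | ht
    · exact (h1 1 le_rfl).trans_le (hα zero_le_one)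
    · exact h1 t ht
  set r : ℝ := (T : ℝ) ^ (1 / 2 + ε) with hr
  have hT' : (1 : ℝ) ≤ T := by exact_mod_cast hT
  have hr1 : 1 ≤ r := Real.one_le_rpow hT' (by positivity)
  have hsqrt : √(T : ℝ) ≤ r := by
    rw [Real.sqrt_eq_rpow]
    exact Real.rpow_le_rpow_of_exponent_le hT' (by linarith)
  have hαT : 1 / α T = r := by
    rw [hα' T hT, Real.rpow_neg (by positivity), one_div, inv_inv]
  have hαsum : ∑ t ∈ Finset.range (T + 1), α t ≤ (α 0 + 2) * r := by
    have h1 := sum_range_one_div_sqrt_le (α := α) (fun t ht => by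
      have ht' : (1 : ℝ) ≤ t := by exact_mod_cast ht
      rw [hα' t ht, Real.sqrt_eq_rpow, one_div (_ ^ _), ← Real.rpow_neg (by positivity)]
      exact Real.rpow_le_rpow_of_exponent_le ht' (by linarith)) T
    have h2 : α 0 ≤ α 0 * r := le_mul_of_one_le_right (hpos 0).le hr1
    linarith
  have hIcc : ∀ f : ℕ → ℝ, (∀ t, 0 ≤ f t) →
      ∑ t ∈ Finset.Icc 1 T, f t ≤ ∑ t ∈ Finset.range (T + 1), f t := fun f hf =>
    Finset.sum_le_sum_of_subset_of_nonneg
      (fun t ht => by simp only [Finset.mem_Icc, Finset.mem_range] at ht ⊢; omega) fun t _ _ => hf t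
  have hℱ := h.run₁.info_le h.run₂
  -- Weights summing to 1 over the opponent's agents force that network to be nonempty.
  have hn₂ : 0 < n₂ := by
    rcases Nat.eq_zero_or_pos n₂ with rfl | h0
    · have := h.adm₁.cross.row_sum 0 i
      simp at this
    · exact h0
  have hconst : ∀ (n B : ℕ) (ν Λ S : ℝ), η ^ (n * B) * S ≤
      (n * B : ℕ) * (2 * Λ + 2 * ((n * B : ℕ) * (n * (1 + L ^ 2 + ν ^ 2) * α 0))) +
      2 * ((n * B : ℕ) * (n * (1 + L ^ 2 + ν ^ 2) * ∑ t ∈ Finset.range (T + 1), α t)) →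
      S ≤ disagreementConstant n B η L ν Λ (α 0) * r := by
    intro n B ν Λ S hS
    have hp : 0 < η ^ (n * B) := by positivity
    rw [disagreementConstant, div_mul_eq_mul_div, le_div_iff₀ hp, mul_comm S]
    refine hS.trans ?_
    have h0 := (hpos 0).le
    rw [add_mul]
    refine add_le_add ?_ ?_
    · calc _ ≤ ((n * B : ℕ) : ℝ) *
            (2 * |Λ| + 2 * ((n * B : ℕ) * (n * (1 + L ^ 2 + ν ^ 2) * α 0))) := by
            gcongr
            exact le_abs_self Λ
        _ ≤ _ := le_mul_of_one_le_right (by positivity) hr1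
    · calc _ ≤ 2 * (((n * B : ℕ) : ℝ) * (n * (1 + L ^ 2 + ν ^ 2) * ((α 0 + 2) * r))) := by
            gcongr
        _ = _ := by ring
  have hS₁ := hconst n₁ B₁ ν₁ Λ₁ _
    (h.run₁.sum_integral_disagreement_le h.unbiased₁ h.adm₁ hη hL
      (h.adm₁.u_mem h.adm₂.X_convex h.run₂.x_mem) hℱ (fun t j =>
        (h.run₁.measurable_x h.adm₁ hη (info_mono p₁ p₂) (measurable_info_left p₁ p₂) t j).mono
          (hℱ t) le_rfl) h.init₁ i.pos hα (fun t => (hpos t).le) (T + 1))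
  have hS₂ := hconst n₂ B₂ ν₂ Λ₂ _
    (h.run₂.sum_integral_disagreement_le h.unbiased₂ h.adm₂ hη hL
      (h.adm₂.u_mem h.adm₁.X_convex h.run₁.x_mem) hℱ (fun t j =>
        (h.run₂.measurable_x h.adm₂ hη (info_mono p₁ p₂) (measurable_info_right p₁ p₂) t j).mono
          (hℱ t) le_rfl) h.init₂ hn₂ hα (fun t => (hpos t).le) (T + 1))
  obtain ⟨-, -, z, hz, hmin⟩ := hex
  have hInf : sInf ((fun x₁ => ∫ ω, fixedCost N₁ p₂ P ξ i T x₁ ω ∂P) '' N₁.X) =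
      ∫ ω, fixedCost N₁ p₂ P ξ i T z ω ∂P :=
    IsLeast.csInf_eq ⟨Set.mem_image_of_mem _ hz, by rintro _ ⟨x, hx, rfl⟩; exact hmin hx⟩
  rw [pseudoRegret, hInf]
  refine (h.integral_played_sub_fixed_le hη hL hα hpos i hT hz).trans ?_
  have hR : R / α T ≤ |R| * r := by
    rw [← hαT, ← mul_div_assoc, mul_one]
    exact div_le_div_of_nonneg_right (le_abs_self R) (hpos T).le
  have hA := mul_le_mul_of_nonneg_left ((hIcc α fun t => (hpos t).le).trans hαsum)
    (by positivity : 0 ≤ L ^ 2 + ν₁ ^ 2)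
  have hD := mul_le_mul_of_nonneg_left (add_le_add
    ((hIcc _ fun t => integral_nonneg fun ω => disagreement_nonneg _).trans hS₁)
    (mul_le_mul_of_nonneg_left
      ((hIcc _ fun t => integral_nonneg fun ω => disagreement_nonneg _).trans hS₂)
      (zero_le_two (α := ℝ)))) hL
  refine (add_le_add (add_le_add hR hA) hD).trans (le_of_eq ?_)
  ring

end DSMD

theorem corollary1 (n₁ n₂ B₁ B₂ : ℕ) (η L ν₁ ν₂ Λ₁ Λ₂ R : ℝ)
    (hη : 0 < η) (hη' : η < 1) (hL : 0 < L) (hν₁ : 0 < ν₁) (hν₂ : 0 < ν₂) :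
    (∀ ε : ℝ, 0 ≤ ε → ε < 1 / 2 → ∀ α : ℕ → ℝ, Antitone α →
      (∀ t : ℕ, 1 ≤ t → α t = (t : ℝ) ^ (-(1 / 2 + ε))) →
      DSMD.RegretOrder.{u, v, w} n₁ n₂ B₁ B₂ η L ν₁ ν₂ Λ₁ Λ₂ R α (fun T => (T : ℝ) ^ (1 / 2 + ε))) ∧
    (∀ α : ℕ → ℝ, Antitone α → (∀ t : ℕ, 1 ≤ t → α t = 1 / √(t : ℝ)) →
      DSMD.RegretOrder.{u, v, w} n₁ n₂ B₁ B₂ η L ν₁ ν₂ Λ₁ Λ₂ R α (fun T => √(T : ℝ))) := by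
  refine ⟨fun ε hε _ α hα hα' =>
    DSMD.regretOrder_rpow n₁ n₂ B₁ B₂ ν₁ ν₂ Λ₁ Λ₂ R hη hL.le hε hα hα', fun α hα hα' => ?_⟩
  have h := DSMD.regretOrder_rpow.{u, v, w} n₁ n₂ B₁ B₂ ν₁ ν₂ Λ₁ Λ₂ R hη hL.le le_rfl hα
    fun t ht => by
      rw [hα' t ht, Real.sqrt_eq_rpow, add_zero, Real.rpow_neg (by positivity), one_div]
  simpa only [add_zero, ← Real.sqrt_eq_rpow] using h
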